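/- **Conventions.** For finitely many spaces $Z_i$ $(i\in I)$, the join $*_{i\in I}Z_i$ is the set of formal convex combinations $\sum_i t_i z_i$ ($t_i\ge 0$, $\sum_i t_i=1$, with $z_i\in Z_i$ recorded only when $t_i>0$), with the coarsest topology making all $t_i$ and all partial maps $z_i$ (defined where $t_i>0$) continuous; for compact Hausdorff spaces this is the usual quotient topology. Empty factors are allowed, so $\emptyset * Z = Z$, and $X^{*n}$ denotes the $n$-fold join of $X$, with $X^{*0}=\emptyset$. For a finite poset $P$, a $P$-diagram $\mathcal D$ consists of spaces $D(p)$ $(p \in P)$ and compatible maps $d_{pq}:D(p)\to D(q)$ for $p\ge q$; its homotopy colimit is $$\operatorname{hocolim}_P\mathcal D=\coprod_{p\in P}\Delta(P_{\le p})\times D(p)\,/\sim,$$ where $\Delta$ is the geometric realization of the order complex and $\sim$ is generated by $(a,x)\sim(a,d_{pq}(x))$ for $p\ge q$, $a\in\Delta(P_{\le q})$, $x\in D(p)$. Let $M$ be a matroid on a finite ground set with rank function $r$, rank $r(M)$ and lattice of flats $L(M)$ (least element $\hat 0$), and let $X$ be a CW complex. For $\rho\in\mathbb N$ with $\rho\ge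 r(M)$, let $B_\rho$ be the lattice of subsets of $[\rho]=\{1,\dots,\rho\}$. A *$\rho$-immersion* of $M$ is an order-reversing map $l:L(M)\to B_\rho$ with $|l(p)|=\rho-r(p)$ for every flat $p$. For $\sigma\in B_\rho$ let $D_X(\sigma)$ be the join over $i=1,\dots,\rho$ of the spaces $X$ (if $i\in\sigma$) and $\emptyset$ (if $i\notin\sigma$), with the inclusions $D_X(\sigma)\subseteq D_X(\tau)$ for $\sigma\subseteq\tau$, and let $\mathcal D_X(M,l)=D_X\circ l$, an $L(M)$-diagram. Put $$\mathcal T_X(M,l)=\bigcup_{a\text{ an atom of }L(M)}\operatorname{hocolim}\,\mathcal D_X(M,l)_{\ge a}\ \subseteq\ \operatorname{hocolim}\,\mathcal D_X(M,l),$$ where $\mathcal D_X(M,l)_{\ge a}$ is the restriction to the flats $p\ge a$. The standard representation is $\mathcal T_X(M)=\mathcal T_X(M,\hat l)$, where $\hat l:L(M)\to B_{r(M)}$ is $\hat l(p)=[r(M)-r(p)]$. **Proposition.** Assume $r(M)\ge 1$ or $\rho=r(M)$. For every $\rho$-immersion $l$ of $M$ there is a homotopy equivalence $$\mathcal T_X(M,l)\;\simeq\;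 X^{*(\rho-r(M))} * \mathcal T_X(M),$$ that is, $\mathcal T_X(M,l)$ is homotopy equivalent to the $(\rho-r(M))$-fold $X$-suspension $X^{*(\rho-r(M))} * (-)$ of the standard representation. -/

import Mathlib

noncomputable section

namespace MatroidTop

open CategoryTheory

universe u v w

/-! ### Joins of spaces -/

/-- The join of a finite family of spaces `Z i`: formal convex combinations `∑ tᵢ zᵢ`, where
`zᵢ ∈ Z i` is recorded only for those `i` with `tᵢ > 0`.  Some, or all, of the `Z i` may be
empty; an empty factor does not contribute. -/
structure Join {ι : Type v} [Fintype ι] (Z : ι → Type u) where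
  weight : ι → ℝ
  weight_mem : weight ∈ stdSimplex ℝ ι
  point : ∀ i, 0 < weight i → Z i

/-- The topology of the join: the coarsest one for which every weight function `tᵢ` is continuous
and every partial function `zᵢ`, defined on the open set `{tᵢ > 0}`, is continuous. -/
instance Join.instTopologicalSpace {ι : Type v} [Fintype ι] (Z : ι → Type u)
    [∀ i, TopologicalSpace (Z i)] : TopologicalSpace (Join Z) :=
  TopologicalSpace.generateFrom
    ({s | ∃ (i : ι) (U : Set ℝ), IsOpen U ∧ s = {z | z.weight i ∈ U}} ∪
     {s | ∃ (i : ι) (V : Set (Z i)), IsOpen V ∧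
        s = {z | ∃ h : 0 < z.weight i, z.point i h ∈ V}})

/-- The map of joins induced by maps of the factors: `∑ tᵢ zᵢ ↦ ∑ tᵢ f(zᵢ)`. -/
def Join.map {ι : Type v} [Fintype ι] {Z : ι → Type u} {W : ι → Type w}
    (f : ∀ i, Z i → W i) (z : Join Z) : Join W where
  weight := z.weight
  weight_mem := z.weight_mem
  point i h := f i (z.point i h)

theorem Join.continuous_map {ι : Type v} [Fintype ι] {Z : ι → Type u} {W : ι → Type w}
    [∀ i, TopologicalSpace (Z i)] [∀ i, TopologicalSpace (W i)]
    {f : ∀ i, Z i → W i} (hf : ∀ i, Continuous (f i)) :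
    Continuous (Join.map f) := by
  refine continuous_generateFrom_iff.2 ?_
  rintro s (⟨i, U, hU, rfl⟩ | ⟨i, V, hV, rfl⟩)
  · exact TopologicalSpace.isOpen_generateFrom_of_mem (Or.inl ⟨i, U, hU, rfl⟩)
  · exact TopologicalSpace.isOpen_generateFrom_of_mem
      (Or.inr ⟨i, f i ⁻¹' V, hV.preimage (hf i), rfl⟩)

/-- The `n`-fold join `X^{*n}`; in particular `X^{*0} = ∅`. -/
abbrev JoinPower (X : Type u) (n : ℕ) : Type u := Join (fun _ : Fin n => X)

/-- The two-member family `A, B`. -/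
def pairFamily (A : Type u) (B : Type v) : Bool → Type (max u v)
  | false => ULift.{v} A
  | true => ULift.{u} B

instance pairFamily.instTopologicalSpace (A : Type u) (B : Type v) [TopologicalSpace A]
    [TopologicalSpace B] : ∀ b, TopologicalSpace (pairFamily A B b)
  | false => inferInstanceAs (TopologicalSpace (ULift.{v} A))
  | true => inferInstanceAs (TopologicalSpace (ULift.{u} B))

/-- The join `A * B` of two spaces. -/
abbrev BinaryJoin (A : Type u) (B : Type v) : Type (max u v) := Join (pairFamily A B)

/-! ### Diagrams of spaces over a finite poset and their homotopy colimits -/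

/-- For an element `p` of a finite poset `P`, the geometric realization `Δ(P_{≤ p})` of the order
complex of `{q | q ≤ p}`, in barycentric coordinates: convex combinations of elements of `P` whose
support is a chain consisting of elements `≤ p`. -/
def OrderComplexBelow (P : Type v) [PartialOrder P] [Fintype P] (p : P) : Type v :=
  {b : P → ℝ // b ∈ stdSimplex ℝ P ∧ IsChain (· ≤ ·) {q | b q ≠ 0} ∧ ∀ q, b q ≠ 0 → q ≤ p}

instance OrderComplexBelow.instTopologicalSpace (P : Type v) [PartialOrder P] [Fintype P] (p : P) :
    TopologicalSpace (OrderComplexBelow P p) :=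
  instTopologicalSpaceSubtype

/-- The inclusion `Δ(P_{≤ q}) ⊆ Δ(P_{≤ p})` for `q ≤ p`. -/
def OrderComplexBelow.incl {P : Type v} [PartialOrder P] [Fintype P] {p q : P} (h : q ≤ p)
    (b : OrderComplexBelow P q) : OrderComplexBelow P p :=
  ⟨b.1, b.2.1, b.2.2.1, fun s hs => (b.2.2.2 s hs).trans h⟩

/-- The disjoint union `∐_p Δ(P_{≤ p}) × D(p)` for a `P`-diagram of spaces `D`.  A `P`-diagram has
a map `D(p) → D(q)` whenever `p ≥ q`, so it is a functor on `Pᵒᵖ` in Mathlib's convention, in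
which there is a morphism `q ⟶ p` of `P` when `q ≤ p`. -/
abbrev PreHocolim {P : Type v} [PartialOrder P] [Fintype P] (D : Pᵒᵖ ⥤ TopCat.{u}) :
    Type (max u v) :=
  Σ p : P, OrderComplexBelow P p × D.obj (Opposite.op p)

/-- The gluing relation: `(a, x) ∼ (a, d_{pq}(x))` for `p ≥ q`, `x ∈ D(p)`, `a ∈ Δ(P_{≤ q})`. -/
inductive HocolimRel {P : Type v} [PartialOrder P] [Fintype P] (D : Pᵒᵖ ⥤ TopCat.{u}) :
    PreHocolim D → PreHocolim D → Prop
  | glue {p q : P} (h : q ≤ p) (a : OrderComplexBelow P q) (x : D.obj (Opposite.op p)) :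
      HocolimRel D ⟨p, a.incl h, x⟩ ⟨q, a, D.map (homOfLE h).op x⟩

/-- The homotopy colimit of a `P`-diagram of spaces, with the quotient topology. -/
def Hocolim {P : Type v} [PartialOrder P] [Fintype P] (D : Pᵒᵖ ⥤ TopCat.{u}) : Type (max u v) :=
  Quot (HocolimRel D)

instance Hocolim.instTopologicalSpace {P : Type v} [PartialOrder P] [Fintype P]
    (D : Pᵒᵖ ⥤ TopCat.{u}) : TopologicalSpace (Hocolim D) :=
  inferInstanceAs (TopologicalSpace (Quot (HocolimRel D)))

/-- The homotopy colimit of the restriction of `D` to `P_{≥ a}`, as a subspace of the homotopy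
colimit of `D`: the classes of all `(b, x)` with `b` supported in `P_{≥ a}`. -/
def hocolimAbove {P : Type v} [PartialOrder P] [Fintype P] (D : Pᵒᵖ ⥤ TopCat.{u}) (a : P) :
    Set (Hocolim D) :=
  {y | ∃ (p : P) (b : OrderComplexBelow P p) (x : D.obj (Opposite.op p)),
    (∀ q, b.1 q ≠ 0 → a ≤ q) ∧ y = Quot.mk (HocolimRel D) ⟨p, b, x⟩}

/-! ### The lattice of flats of a matroid -/

/-- The poset (lattice) of flats of a matroid, ordered by inclusion. -/
def Flats {α : Type v} (M : Matroid α) : Type v := {F : Set α // M.IsFlat F}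

instance {α : Type v} (M : Matroid α) : PartialOrder (Flats M) :=
  inferInstanceAs (PartialOrder {F : Set α // M.IsFlat F})

instance {α : Type v} (M : Matroid α) [M.Finite] : Fintype (Flats M) :=
  have : Finite (Flats M) :=
    (M.ground_finite.finite_subsets.subset fun _ hF => hF.subset_ground :
      {F : Set α | M.IsFlat F}.Finite).to_subtype
  Fintype.ofFinite _

/-- The least flat is the closure of the empty set. -/
instance {α : Type v} (M : Matroid α) : OrderBot (Flats M) where
  bot := ⟨M.closure ∅, M.isFlat_closure ∅⟩
  bot_le F := show M.closure ∅ ⊆ F.1 from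
    (M.closure_subset_closure (Set.empty_subset F.1)).trans F.2.closure.subset

/-- The rank of a set in a finite matroid, as a natural number. -/
def rk {α : Type v} (M : Matroid α) (A : Set α) : ℕ := (M.eRk A).toNat

/-- The rank `r(M)` of a finite matroid. -/
def rank {α : Type v} (M : Matroid α) : ℕ := rk M M.E

theorem rk_mono {α : Type v} (M : Matroid α) [M.Finite] {A B : Set α} (h : A ⊆ B) :
    rk M A ≤ rk M B :=
  ENat.toNat_le_toNat (M.eRk_mono h) (M.eRk_ne_top_iff.2 (M.isRkFinite_set B))

/-! ### Immersions and topological representations -/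

/-- A `ρ`-immersion of a matroid `M`: a rank- and order-reversing map `l` from the lattice of flats
to the boolean lattice `B_ρ` on `ρ` elements, that is, `|l(p)| = ρ - r(p)` for every flat `p`
(with `r(p) ≤ ρ`), and `l(q) ⊆ l(p)` whenever `p ≤ q`. -/
structure Immersion {α : Type v} (M : Matroid α) (ρ : ℕ) where
  toFun : Flats M → Finset (Fin ρ)
  antitone : Antitone toFun
  card_add_rk : ∀ p, (toFun p).card + rk M p.1 = ρ

/-- The canonical immersion `p ↦ [ρ - r(p)]`, for `ρ ≥ r(M)`. -/
def canonicalImmersion {α : Type v} (M : Matroid α) [M.Finite] (ρ : ℕ) (hρ : rank M ≤ ρ) :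
    Immersion M ρ where
  toFun p := Finset.univ.filter fun i : Fin ρ => i.val < ρ - rk M p.1
  antitone p q h := by
    have h' : rk M p.1 ≤ rk M q.1 := rk_mono M h
    intro i
    simp only [Finset.mem_filter, Finset.mem_univ, true_and]
    omega
  card_add_rk p := by
    have h' : rk M p.1 ≤ rank M := rk_mono M p.2.subset_ground
    rw [Fin.card_filter_val_lt]
    omega

/-- The `B_ρ`-diagram `D_X`: the space `D_X(σ)` is the join over `i = 1, …, ρ` of the spaces `X`
(if `i ∈ σ`) and `∅` (if `i ∉ σ`), and the maps are the inclusions `D_X(σ) ⊆ D_X(τ)` for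
`σ ⊆ τ`. -/
def booleanDiagram (X : Type u) [TopologicalSpace X] (ρ : ℕ) :
    Finset (Fin ρ) ⥤ TopCat.{u} where
  obj σ := TopCat.of (Join fun i : Fin ρ => {_x : X // i ∈ σ})
  map f := TopCat.ofHom
    ⟨Join.map fun _ x => ⟨x.1, leOfHom f x.2⟩,
      Join.continuous_map fun _ => continuous_subtype_val.subtype_mk _⟩

/-- An immersion as a functor from the opposite of the lattice of flats to `B_ρ`. -/
def Immersion.functor {α : Type v} {M : Matroid α} {ρ : ℕ} (l : Immersion M ρ) :
    (Flats M)ᵒᵖ ⥤ Finset (Fin ρ) where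
  obj p := l.toFun p.unop
  map f := homOfLE (l.antitone (leOfHom f.unop))

/-- The diagram of spaces `D_X(M, l) = D_X ∘ l` over the lattice of flats of `M`. -/
def flatDiagram {α : Type v} {M : Matroid α} {ρ : ℕ} (X : Type u) [TopologicalSpace X]
    (l : Immersion M ρ) : (Flats M)ᵒᵖ ⥤ TopCat.{u} :=
  l.functor ⋙ booleanDiagram X ρ

/-- The topological representation `T_X(M, l)`: the union, over the atoms `a` of the lattice of
flats, of the homotopy colimits of the restrictions of `D_X(M, l)` to the flats above `a`, inside
the homotopy colimit of `D_X(M, l)`. -/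
def rep {α : Type v} {M : Matroid α} [M.Finite] {ρ : ℕ} (X : Type u) [TopologicalSpace X]
    (l : Immersion M ρ) : Set (Hocolim (flatDiagram X l)) :=
  ⋃ a ∈ {a : Flats M | IsAtom a}, hocolimAbove (flatDiagram X l) a

/-- The standard representation `T_X(M)`: the one given by the canonical immersion with
`ρ = r(M)`. -/
def standardRep {α : Type v} (M : Matroid α) [M.Finite] (X : Type u) [TopologicalSpace X] :
    Set (Hocolim (flatDiagram X (canonicalImmersion M (rank M) le_rfl))) :=
  rep X (canonicalImmersion M (rank M) le_rfl)

end MatroidTop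

end

/-!
In coordinates, `rep X l` consists of the pairs `(b, x)` where `b` is a point of the order complex
of the flats `p ≠ ⊥` and `x` is a point of the join over all indices, supported in `l p` whenever
`0 < b p`. As `l` is strictly antitone, the inclusion `l q ⊂ l p` misses an index for `p < q`, so
the inclusions of the joins can be contracted to points, compatibly with composition. Performing
these contractions one flat at a time shows that the homotopy colimit only depends on the joins
over the sets `l p` up to homeomorphism, that is, on the cardinalities `ρ - r(p)`.

So `l` may be replaced by the canonical immersion with `ρ - r(M)` further indices added to every
set, whose homotopy colimit is the fibrewise join, over the order complex `Δ`, of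
`E = X^{*(ρ - r(M))}` with the standard representation. As `r(M) ≥ 1`, the ground set is a flat
different from `⊥`, so `Δ` is star-shaped about a vertex, and collapsing the subspace `Δ × E` of
the fibrewise join to `E` is a homotopy equivalence onto the join.
-/

noncomputable section

namespace MatroidTop

universe u v w

/-! ### Maps into joins -/

section Generalities

variable {Y : Type*} [TopologicalSpace Y]

theorem continuous_of_exists_isOpen {E : Type*} [TopologicalSpace E] {f : Y → E}
    (h : ∀ y, ∃ V : Set Y, IsOpen V ∧ y ∈ V ∧ Continuous fun v : V => f v) : Continuous f := by
  rw [continuous_iff_continuousAt]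
  intro y
  obtain ⟨V, hV, hy, hc⟩ := h y
  exact (continuousOn_iff_continuous_domRestrict.2 hc).continuousAt (hV.mem_nhds hy)

variable {ι : Type v} [Fintype ι] {Z : ι → Type u}

theorem Join.ext {z w : Join Z} (hw : ∀ i, z.weight i = w.weight i)
    (hp : ∀ i h h', z.point i h = w.point i h') : z = w := by
  obtain ⟨a, ha, x⟩ := z
  obtain ⟨b, hb, y⟩ := w
  obtain rfl : a = b := funext hw
  obtain rfl : x = y := funext fun i => funext fun h => hp i h h
  rfl

theorem Join.weight_nonneg (z : Join Z) (i : ι) : 0 ≤ z.weight i := z.weight_mem.1 i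

theorem Join.sum_weight (z : Join Z) : ∑ i, z.weight i = 1 := z.weight_mem.2

theorem exists_pos_of_mem_stdSimplex {b : ι → ℝ} (hb : b ∈ stdSimplex ℝ ι) : ∃ i, 0 < b i := by
  by_contra! h
  have := Finset.sum_nonpos fun i (_ : i ∈ Finset.univ) => h i
  linarith [hb.2]

theorem Join.isEmpty [∀ i, IsEmpty (Z i)] : IsEmpty (Join Z) := by
  refine ⟨fun z => ?_⟩
  obtain ⟨i, hi⟩ := exists_pos_of_mem_stdSimplex z.weight_mem
  exact isEmptyElim (z.point i hi)

variable [∀ i, TopologicalSpace (Z i)]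

theorem Join.continuous_weight (i : ι) : Continuous fun z : Join Z => z.weight i :=
  continuous_def.2 fun U hU =>
    TopologicalSpace.isOpen_generateFrom_of_mem (Or.inl ⟨i, U, hU, rfl⟩)

theorem Join.continuous_weight_comp {f : Y → Join Z} (hf : Continuous f) (i : ι) :
    Continuous fun y => (f y).weight i :=
  (Join.continuous_weight i).comp hf

theorem Join.continuous_point (i : ι) :
    Continuous fun z : {z : Join Z // 0 < z.weight i} => z.1.point i z.2 := by
  refine continuous_def.2 fun V hV => ?_
  have h : IsOpen {z : Join Z | ∃ h : 0 < z.weight i, z.point i h ∈ V} :=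
    TopologicalSpace.isOpen_generateFrom_of_mem (Or.inr ⟨i, V, hV, rfl⟩)
  convert h.preimage continuous_subtype_val using 1
  ext z
  exact ⟨fun hz => ⟨z.2, hz⟩, fun ⟨_, hz⟩ => hz⟩

theorem Join.continuous_point_comp {f : Y → Join Z} (hf : Continuous f) (i : ι)
    (hi : ∀ y, 0 < (f y).weight i) : Continuous fun y => (f y).point i (hi y) :=
  (Join.continuous_point i).comp (hf.subtype_mk hi)

theorem Join.continuous_of {f : Y → Join Z} (hw : ∀ i, Continuous fun y => (f y).weight i)
    (hp : ∀ i, Continuous fun y : {y // 0 < (f y).weight i} => (f y.1).point i y.2) :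
    Continuous f := by
  refine continuous_generateFrom_iff.2 ?_
  rintro s (⟨i, U, hU, rfl⟩ | ⟨i, V, hV, rfl⟩)
  · exact hU.preimage (hw i)
  · have ho : IsOpen {y | 0 < (f y).weight i} := isOpen_lt continuous_const (hw i)
    convert ho.isOpenMap_subtype_val _ (hV.preimage (hp i)) using 1
    ext y
    constructor
    · rintro ⟨h, hy⟩
      exact ⟨⟨y, h⟩, hy, rfl⟩
    · rintro ⟨⟨y, h⟩, hy, rfl⟩
      exact ⟨h, hy⟩

/-- The homeomorphism of joins induced by homeomorphisms of the factors. -/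
def Join.homeomorph {W : ι → Type w} [∀ i, TopologicalSpace (W i)] (e : ∀ i, Z i ≃ₜ W i) :
    Join Z ≃ₜ Join W where
  toFun := Join.map fun i => e i
  invFun := Join.map fun i => (e i).symm
  left_inv _ := Join.ext (fun _ => rfl) fun i _ _ => (e i).symm_apply_apply _
  right_inv _ := Join.ext (fun _ => rfl) fun i _ _ => (e i).apply_symm_apply _
  continuous_toFun := Join.continuous_map fun i => (e i).continuous
  continuous_invFun := Join.continuous_map fun i => (e i).symm.continuous

/-- The point of a join whose weights are proportional to the given family `a`. -/
def Join.normalize (a : ι → ℝ) (h0 : ∀ i, 0 ≤ a i) (h1 : 0 < ∑ i, a i)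
    (x : ∀ i, 0 < a i → Z i) : Join Z where
  weight i := a i / ∑ j, a j
  weight_mem := ⟨fun i => div_nonneg (h0 i) h1.le, by
    rw [← Finset.sum_div, div_self h1.ne']⟩
  point i h := x i ((div_pos_iff_of_pos_right h1).1 h)

theorem Join.continuous_normalize {a : Y → ι → ℝ} {h0 : ∀ y i, 0 ≤ a y i}
    {h1 : ∀ y, 0 < ∑ i, a y i} {x : ∀ y i, 0 < a y i → Z i}
    (ha : ∀ i, Continuous fun y => a y i)
    (hx : ∀ i, Continuous fun y : {y // 0 < a y i} => x y.1 i y.2) :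
    Continuous fun y => Join.normalize (a y) (h0 y) (h1 y) (x y) := by
  refine Join.continuous_of (fun i => ?_) fun i => ?_
  · exact (ha i).div (continuous_finsetSum _ fun j _ => ha j) fun y => (h1 y).ne'
  · have : Continuous fun y : {y // 0 < (Join.normalize (a y) (h0 y) (h1 y) (x y)).weight i} =>
        (⟨y.1, (div_pos_iff_of_pos_right (h1 y.1)).1 y.2⟩ : {y // 0 < a y i}) :=
      continuous_subtype_val.subtype_mk _
    exact (hx i).comp this

end Generalities

/-! ### Shifting weights -/

section Shift

variable {P : Type v} [PartialOrder P]

open Classical in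
/-- The part of the weight of `p` that `shift m` moves to `m`. -/
def shiftedPart (m : P) (w : P → ℝ) (p : P) : ℝ := if m < p then min (w p) (w m) else 0

variable {m p : P} {w : P → ℝ}

theorem continuous_shiftedPart (m p : P) : Continuous fun w : P → ℝ => shiftedPart m w p := by
  unfold shiftedPart
  split_ifs <;> fun_prop

theorem shiftedPart_nonneg (hw : ∀ p, 0 ≤ w p) (p : P) : 0 ≤ shiftedPart m w p := by
  unfold shiftedPart
  split_ifs
  exacts [le_min (hw p) (hw m), le_rfl]

theorem shiftedPart_le (hw : ∀ p, 0 ≤ w p) (p : P) : shiftedPart m w p ≤ w p := by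
  unfold shiftedPart
  split_ifs
  exacts [min_le_left _ _, hw p]

theorem shiftedPart_le_apex (hw : ∀ p, 0 ≤ w p) (p : P) : shiftedPart m w p ≤ w m := by
  unfold shiftedPart
  split_ifs
  exacts [min_le_right _ _, hw m]

variable [Fintype P]

open Classical in
/-- The operation on points of a simplex that moves to the vertex `m` the part `min (w p) (w m)` of
the weight of every vertex `p` above `m`. Vertices do not enter the support, and those above `m`
stay in it only if they outweigh `m`. -/
def shift (m : P) (w : P → ℝ) (p : P) : ℝ :=
  w p - shiftedPart m w p + if p = m then ∑ q, shiftedPart m w q else 0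

open Classical in
/-- The total weight above `m`. -/
def above (m : P) (w : P → ℝ) : ℝ := ∑ p with m < p, w p

theorem continuous_shift (m : P) : Continuous (shift m) := by
  have := continuous_shiftedPart m
  refine continuous_pi fun p => ?_
  unfold shift
  split_ifs <;> fun_prop

theorem continuous_above (m : P) : Continuous (above m) := by
  unfold above
  fun_prop

theorem shift_mem_stdSimplex (hw : w ∈ stdSimplex ℝ P) : shift m w ∈ stdSimplex ℝ P := by
  refine ⟨fun p => add_nonneg (sub_nonneg.2 (shiftedPart_le hw.1 p)) ?_, ?_⟩
  · split_ifs
    exacts [Finset.sum_nonneg fun q _ => shiftedPart_nonneg hw.1 q, le_rfl]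
  · simp only [shift, Finset.sum_add_distrib, Finset.sum_sub_distrib, hw.2]
    rw [Fintype.sum_eq_single m fun j hj => if_neg hj, if_pos rfl, sub_add_cancel]

theorem pos_of_shift_pos (hw : ∀ p, 0 ≤ w p) (h : 0 < shift m w p) : 0 < w p := by
  refine (hw p).lt_of_ne' fun hp => ?_
  have hp0 : shiftedPart m w p = 0 :=
    le_antisymm (hp ▸ shiftedPart_le hw p) (shiftedPart_nonneg hw p)
  rw [shift, hp, hp0, sub_zero, zero_add] at h
  split_ifs at h with hpm
  · subst hpm
    exact h.not_ge (Finset.sum_nonpos fun q _ => hp ▸ shiftedPart_le_apex hw q)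
  · exact h.false

theorem shift_apex_pos (hw : ∀ p, 0 ≤ w p) (h : 0 < w m) : 0 < shift m w m := by
  rw [shift, if_pos rfl, shiftedPart, if_neg (lt_irrefl m), sub_zero]
  exact add_pos_of_pos_of_nonneg h (Finset.sum_nonneg fun q _ => shiftedPart_nonneg hw q)

theorem exists_pos_of_above_pos (h : 0 < above m w) : ∃ p, m < p ∧ 0 < w p := by
  classical
  by_contra! h'
  exact h.not_ge (Finset.sum_nonpos fun p hp => h' p (Finset.mem_filter.1 hp).2)

theorem lt_above_of_shift_pos (hw : ∀ p, 0 ≤ w p) (hp : m < p) (h : 0 < shift m w p) :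
    w m < above m w := by
  classical
  have hmp : w m < w p := by
    by_contra! h'
    simp [shift, shiftedPart, hp, hp.ne', min_eq_left h'] at h
  exact hmp.trans_le (Finset.single_le_sum (f := w) (fun q _ => hw q) (by simp [hp]))

/-- A function on the simplex equal to `0` where the weight above `m` is at most half of the weight
of `m` and to `1` where it is at least the weight of `m`. -/
def progress (m : P) (w : P → ℝ) : ℝ :=
  Set.projIcc (0 : ℝ) 1 zero_le_one (2 * (above m w / w m) - 1)

theorem progress_eq_zero (hm : 0 < w m) (h : 2 * above m w ≤ w m) : progress m w = 0 := by
  rw [progress, Set.projIcc_of_le_left]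
  have : above m w / w m ≤ 1 / 2 := by
    rw [div_le_div_iff₀ hm two_pos]
    linarith
  linarith

theorem progress_eq_one (hm : 0 < w m) (h : w m ≤ above m w) : progress m w = 1 := by
  rw [progress, Set.projIcc_of_right_le]
  have := (one_le_div hm).2 h
  linarith

theorem progress_eq_one_of_shift_pos (hw : ∀ p, 0 ≤ w p) (hm : 0 < w m) (hp : m < p)
    (h : 0 < shift m w p) : progress m w = 1 :=
  progress_eq_one hm (lt_above_of_shift_pos hw hp h).le

theorem progress_eq_zero_of_forall_not_pos (hm : 0 < w m) (h : ∀ p, m < p → ¬ 0 < w p) :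
    progress m w = 0 := by
  refine progress_eq_zero hm ?_
  have : ¬ 0 < above m w := fun h' => (exists_pos_of_above_pos h').elim fun p hp => h p hp.1 hp.2
  linarith

theorem continuousOn_progress (m : P) : ContinuousOn (progress m) {w | 0 < w m} := by
  have := (continuous_above m).continuousOn (s := {w | 0 < w m})
  refine (continuous_subtype_val.comp continuous_projIcc).comp_continuousOn ?_
  exact (continuousOn_const.mul (this.div (by fun_prop) fun w hw => ne_of_gt hw)).sub
    continuousOn_const

/-- The difference between the progress before and after a shift. -/
def lag (m : P) (w : P → ℝ) : ℝ := progress m w - progress m (shift m w)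

theorem lag_eq_zero_of_shift_shift_pos (hw : w ∈ stdSimplex ℝ P) (hp : m < p)
    (h : 0 < shift m (shift m w) p) (hm : 0 < shift m w m) : lag m w = 0 := by
  have hw' := (shift_mem_stdSimplex (m := m) hw).1
  rw [lag, progress_eq_one_of_shift_pos hw' hm hp h, progress_eq_one_of_shift_pos hw.1
    (pos_of_shift_pos hw.1 hm) hp (pos_of_shift_pos hw' h), sub_self]

theorem lag_eq_zero_of_two_mul_above_le (hw : ∀ p, 0 ≤ w p) (hm : 0 < w m)
    (h : 2 * above m w ≤ w m) : lag m w = 0 := by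
  have hnot : ∀ p, m < p → ¬ 0 < shift m w p := fun p hp hpos => by
    linarith [lt_above_of_shift_pos hw hp hpos]
  rw [lag, progress_eq_zero hm h, progress_eq_zero_of_forall_not_pos (shift_apex_pos hw hm) hnot,
    sub_self]

theorem continuousOn_lag (m : P) : ContinuousOn (lag m) {w | 0 < w m ∧ 0 < shift m w m} :=
  ((continuousOn_progress m).mono fun _ h => h.1).sub
    ((continuousOn_progress m).comp (continuous_shift m).continuousOn fun _ h => h.2)

end Shift

/-! ### Diagrams with contracted structure maps -/

/-- A diagram of spaces over a poset together with null-homotopies of its structure maps to smaller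
indices: `pull h t` deforms the structure map `pull h 0` to a map `pull h 1` which is constant, with
the same value for all indices above the target. The null-homotopies are compatible with the
structure maps of the diagram. -/
structure ContractedDiagram (P : Type v) [PartialOrder P] where
  obj : P → Type u
  [top : ∀ p, TopologicalSpace (obj p)]
  pull {m p : P} (h : m < p) : ℝ → obj p → obj m
  continuous_pull {m p : P} (h : m < p) : Continuous fun q : ℝ × obj p => pull h q.1 q.2
  pull_pull_zero {m p q : P} (h : m < p) (h' : p < q) (t : ℝ) (x : obj q) :
    pull h t (pull h' 0 x) = pull (h.trans h') t x
  pull_one {m p q : P} (h : m < p) (h' : m < q) (x : obj p) (y : obj q) :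
    pull h 1 x = pull h' 1 y

attribute [instance] ContractedDiagram.top

namespace ContractedDiagram

variable {P : Type v} [PartialOrder P] [Fintype P] (D : ContractedDiagram.{u} P) {A : Set P}
  {c c' : P → ℝ} {m : P}

/-- The points of the join of the spaces of a diagram which are supported on a chain in `A` and
whose points `z_q` and `z_p`, `q < p`, are related by `z_q = pull (c q) z_p`. For `c = 0` this is
the homotopy colimit over `A`. -/
def colim (A : Set P) (c : P → ℝ) : Set (Join D.obj) :=
  {z | (∀ p, 0 < z.weight p → p ∈ A) ∧ IsChain (· ≤ ·) {p | 0 < z.weight p} ∧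
    ∀ ⦃q p⦄ (h : q < p) (hq : 0 < z.weight q) (hp : 0 < z.weight p),
      z.point q hq = D.pull h (c q) (z.point p hp)}

/-- A homeomorphism of diagrams compatible with the constant maps `pull 1` induces a homeomorphism
of the spaces `colim A 1`. -/
def colimOneHomeomorph {D D' : ContractedDiagram.{u} P} (A : Set P) (e : ∀ p, D.obj p ≃ₜ D'.obj p)
    (he : ∀ ⦃q p⦄ (h : q < p) (x : D.obj p), e q (D.pull h 1 x) = D'.pull h 1 (e p x)) :
    D.colim A 1 ≃ₜ D'.colim A 1 :=
  (Join.homeomorph e).subtype fun z => and_congr_right' <| and_congr_right' <| by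
    refine forall₃_congr fun q p h => forall₂_congr fun hq hp => ?_
    change _ ↔ e q (z.point q hq) = D'.pull h 1 (e p (z.point p hp))
    rw [← he, (e q).injective.eq_iff]
    rfl

variable {D}

theorem pull_point_eq (hup : ∀ p, m < p → c p = 0) {z : Join D.obj} (hz : z ∈ D.colim A c) (t : ℝ)
    {p q : P} (hmp : m < p) (hmq : m < q) (hp : 0 < z.weight p) (hq : 0 < z.weight q) :
    D.pull hmp t (z.point p hp) = D.pull hmq t (z.point q hq) := by
  wlog hpq : p ≤ q generalizing p q
  · exact (this hmq hmp hq hp ((hz.2.1.total hp hq).resolve_left hpq)).symm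
  obtain rfl | hlt := hpq.eq_or_lt
  · rfl
  · rw [hz.2.2 hlt hp hq, hup p hmp, D.pull_pull_zero]

open Classical in
/-- The image at time `t` in the space at `m` of the points `z_p` with `p > m`; if there are none,
the point `z_m` itself. -/
def retimedPoint (m : P) (t : ℝ) (z : Join D.obj) (hm : 0 < z.weight m) : D.obj m :=
  if h : ∃ p, m < p ∧ 0 < z.weight p then
    D.pull h.choose_spec.1 t (z.point h.choose h.choose_spec.2)
  else z.point m hm

theorem retimedPoint_eq_pull (hup : ∀ p, m < p → c p = 0) {z : Join D.obj} (hz : z ∈ D.colim A c)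
    (t : ℝ) (hm : 0 < z.weight m) {p : P} (hmp : m < p) (hp : 0 < z.weight p) :
    retimedPoint m t z hm = D.pull hmp t (z.point p hp) := by
  have h : ∃ p, m < p ∧ 0 < z.weight p := ⟨p, hmp, hp⟩
  rw [retimedPoint, dif_pos h]
  exact pull_point_eq hup hz t _ _ _ _

theorem retimedPoint_eq_point {z : Join D.obj} (t : ℝ) (hm : 0 < z.weight m)
    (h : ∀ p, m < p → ¬ 0 < z.weight p) : retimedPoint m t z hm = z.point m hm :=
  dif_neg fun ⟨p, hmp, hp⟩ => h p hmp hp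

theorem retimedPoint_self {z : Join D.obj} (hz : z ∈ D.colim A c) (hm : 0 < z.weight m) :
    retimedPoint m (c m) z hm = z.point m hm := by
  by_cases h : ∃ p, m < p ∧ 0 < z.weight p
  · rw [retimedPoint, dif_pos h]
    exact (hz.2.2 h.choose_spec.1 hm h.choose_spec.2).symm
  · exact dif_neg h

open Classical in
/-- Change the weights of `z` to `w`, and its point at `m` to `retimedPoint m t z`. -/
def retime (m : P) (t : ℝ) (z : Join D.obj) (w : P → ℝ) (hw : w ∈ stdSimplex ℝ P)
    (hs : ∀ p, 0 < w p → 0 < z.weight p) : Join D.obj where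
  weight := w
  weight_mem := hw
  point p h := Function.update (β := fun p => 0 < w p → D.obj p)
    (fun p h => z.point p (hs p h)) m (fun h => retimedPoint m t z (hs m h)) p h

variable {t : ℝ} {z : Join D.obj} {w : P → ℝ} {hw : w ∈ stdSimplex ℝ P}
  {hs : ∀ p, 0 < w p → 0 < z.weight p}

theorem retime_point_self (h : 0 < (retime m t z w hw hs).weight m) :
    (retime m t z w hw hs).point m h = retimedPoint m t z (hs m h) := by
  simp only [retime, Function.update_self]

theorem retime_point_of_ne {p : P} (hpm : p ≠ m) (h : 0 < (retime m t z w hw hs).weight p) :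
    (retime m t z w hw hs).point p h = z.point p (hs p h) := by
  classical
  simp only [retime, Function.update_of_ne hpm]

theorem retime_congr {t' : ℝ} {w' : P → ℝ} (ht : t = t') (hww' : w = w')
    {hw' : w' ∈ stdSimplex ℝ P} {hs' : ∀ p, 0 < w' p → 0 < z.weight p} :
    retime m t z w hw hs = retime m t' z w' hw' hs' := by
  subst ht hww'
  rfl

theorem retime_self (hz : z ∈ D.colim A c) :
    retime m (c m) z z.weight z.weight_mem (fun _ => id) = z := by
  refine Join.ext (fun _ => rfl) fun p h _ => ?_
  obtain rfl | hpm := eq_or_ne p m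
  · exact (retime_point_self h).trans (retimedPoint_self hz h)
  · exact retime_point_of_ne hpm h

theorem retime_mem_colim (hup : ∀ p, m < p → c p = 0) (hlow : ∀ q, q < m → c q = 1)
    (hz : z ∈ D.colim A c) (hcc' : ∀ p, p ≠ m → c' p = c p)
    (ht : ∀ p, m < p → 0 < w p → 0 < w m → t = c' m) :
    retime m t z w hw hs ∈ D.colim A c' := by
  refine ⟨fun p hp => hz.1 p (hs p hp), hz.2.1.mono fun p hp => hs p hp, fun q p h hq hp => ?_⟩
  obtain rfl | hqm := eq_or_ne q m
  · rw [retime_point_self hq, retime_point_of_ne h.ne' hp,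
      retimedPoint_eq_pull hup hz t _ h (hs p hp), ht p h hp hq]
  rw [hcc' q hqm, retime_point_of_ne hqm hq]
  obtain rfl | hpm := eq_or_ne p m
  · rw [hz.2.2 h (hs q hq) (hs p hp), hlow q h]
    exact D.pull_one _ _ _ _
  · rw [retime_point_of_ne hpm hp]
    exact hz.2.2 h (hs q hq) (hs p hp)

theorem retime_retime (hup : ∀ p, m < p → c p = 0) (hup' : ∀ p, m < p → c' p = 0)
    (hz : z ∈ D.colim A c) (hz' : retime m t z w hw hs ∈ D.colim A c') {w' : P → ℝ}
    {hw' : w' ∈ stdSimplex ℝ P} {hs' : ∀ p, 0 < w' p → 0 < (retime m t z w hw hs).weight p}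
    {t' t'' : ℝ} (hpos : ∀ p, m < p → 0 < w p → 0 < w m → t'' = t')
    (hzero : (∀ p, m < p → ¬ 0 < w p) → 0 < w m → t'' = t) :
    retime m t' (retime m t z w hw hs) w' hw' hs' =
      retime m t'' z w' hw' fun p hp => hs p (hs' p hp) := by
  refine Join.ext (fun _ => rfl) fun p h h' => ?_
  obtain rfl | hpm := eq_or_ne p m
  · rw [retime_point_self h, retime_point_self h']
    by_cases hex : ∃ q, p < q ∧ 0 < w q
    · obtain ⟨q, hpq, hq⟩ := hex
      rw [retimedPoint_eq_pull hup' hz' t' _ hpq hq, retime_point_of_ne hpq.ne' hq,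
        retimedPoint_eq_pull hup hz t'' _ hpq (hs q hq), hpos q hpq hq (hs' p h)]
    · have hnot : ∀ q, p < q → ¬ 0 < w q := fun q hpq hq => hex ⟨q, hpq, hq⟩
      rw [retimedPoint_eq_point t' _ hnot, retime_point_self, hzero hnot (hs' p h)]
  · rw [retime_point_of_ne hpm h, retime_point_of_ne hpm h', retime_point_of_ne hpm]

section Continuity

variable {Y : Type*} [TopologicalSpace Y] {f : Y → D.colim A c} (hf : Continuous f)

include hf

theorem continuous_retimedPoint (hup : ∀ p, m < p → c p = 0) {t : Y → ℝ} (ht : Continuous t)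
    (hm : ∀ y, 0 < (f y).1.weight m)
    (ht' : ∀ y, 2 * above m (f y).1.weight ≤ (f y).1.weight m → t y = c m) :
    Continuous fun y => retimedPoint m (t y) (f y).1 (hm y) := by
  have hfj : Continuous fun y => (f y).1 := continuous_subtype_val.comp hf
  have hfw := Join.continuous_weight_comp hfj
  have hfa : Continuous fun y => above m (f y).1.weight :=
    (continuous_above m).comp (continuous_pi hfw)
  refine continuous_of_exists_isOpen fun y => ?_
  by_cases hy : 2 * above m (f y).1.weight < (f y).1.weight m
  · refine ⟨{y | 2 * above m (f y).1.weight < (f y).1.weight m},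
      isOpen_lt (hfa.const_mul 2) (hfw m), hy, ?_⟩
    refine (Join.continuous_point_comp (hfj.comp continuous_subtype_val) m fun v => hm v.1).congr
      fun v => ?_
    rw [ht' v.1 v.2.le]
    exact (retimedPoint_self (f v.1).2 (hm v.1)).symm
  · obtain ⟨p, hmp, hp⟩ : ∃ p, m < p ∧ 0 < (f y).1.weight p :=
      exists_pos_of_above_pos (by linarith [hm y])
    refine ⟨{y | 0 < (f y).1.weight p}, isOpen_lt continuous_const (hfw p), hp, ?_⟩
    have hpoint := Join.continuous_point_comp (hfj.comp continuous_subtype_val) p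
      fun v : {y | 0 < (f y).1.weight p} => v.2
    exact ((D.continuous_pull hmp).comp ((ht.comp continuous_subtype_val).prodMk hpoint)).congr
      fun v => (retimedPoint_eq_pull hup (f v.1).2 _ _ hmp v.2).symm

theorem continuous_retime (hup : ∀ p, m < p → c p = 0) {w : Y → P → ℝ} (hwc : Continuous w)
    {hw : ∀ y, w y ∈ stdSimplex ℝ P} {hs : ∀ y p, 0 < w y p → 0 < (f y).1.weight p} {t : Y → ℝ}
    (ht : ContinuousOn t {y | 0 < w y m})
    (ht' : ∀ y, 0 < w y m → 2 * above m (f y).1.weight ≤ (f y).1.weight m → t y = c m) :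
    Continuous fun y => retime m (t y) (f y).1 (w y) (hw y) (hs y) := by
  refine Join.continuous_of (fun p => (continuous_apply p).comp hwc) fun p => ?_
  obtain rfl | hpm := eq_or_ne p m
  · exact (continuous_retimedPoint (hf.comp continuous_subtype_val) hup
      (continuousOn_iff_continuous_domRestrict.1 ht) (fun v => hs v.1 p v.2)
      fun v => ht' v.1 v.2).congr fun v => (retime_point_self v.2).symm
  · exact (Join.continuous_point_comp (continuous_subtype_val.comp (hf.comp continuous_subtype_val))
      p fun v : {y // 0 < w y p} => hs v.1 p v.2).congr fun v => (retime_point_of_ne hpm v.2).symm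

end Continuity

theorem continuous_colim_weight : Continuous fun z : D.colim A c => z.1.weight :=
  continuous_pi (Join.continuous_weight_comp continuous_subtype_val)

section RoundTrip

variable (hup : ∀ p, m < p → c p = 0) (hlow : ∀ q, q < m → c q = 1)

theorem weight_pos_of_shift_shift_pos (z : Join D.obj) (p : P)
    (h : 0 < shift m (shift m z.weight) p) : 0 < z.weight p :=
  pos_of_shift_pos z.weight_nonneg (pos_of_shift_pos (shift_mem_stdSimplex z.weight_mem).1 h)

/-- The self-maps of `colim A c`, for `d` in `ℝ`, that shift the weights twice to `m` and delay the
time at `m` by `d` times the lag. -/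
def doubleShift : C(ℝ × D.colim A c, D.colim A c) where
  toFun q := ⟨retime m (c m + lag m q.2.1.weight * q.1) q.2.1 (shift m (shift m q.2.1.weight))
    (shift_mem_stdSimplex (shift_mem_stdSimplex q.2.1.weight_mem))
    (weight_pos_of_shift_shift_pos q.2.1),
    retime_mem_colim hup hlow q.2.2 (fun _ _ => rfl) fun p hmp hp hm => by
      rw [lag_eq_zero_of_shift_shift_pos q.2.1.weight_mem hmp hp
        (pos_of_shift_pos (shift_mem_stdSimplex q.2.1.weight_mem).1 hm), zero_mul, add_zero]⟩
  continuous_toFun := by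
    have hw : Continuous fun q : ℝ × D.colim A c => q.2.1.weight :=
      continuous_colim_weight.comp continuous_snd
    have hpos : ∀ q : ℝ × D.colim A c, 0 < shift m (shift m q.2.1.weight) m →
        0 < q.2.1.weight m ∧ 0 < shift m q.2.1.weight m := fun q hm =>
      ⟨weight_pos_of_shift_shift_pos _ _ hm,
        pos_of_shift_pos (shift_mem_stdSimplex q.2.1.weight_mem).1 hm⟩
    refine (continuous_retime continuous_snd hup
      ((continuous_shift m).comp ((continuous_shift m).comp hw))
      (continuousOn_const.add (((continuousOn_lag m).comp hw.continuousOn hpos).mul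
        continuous_fst.continuousOn)) fun q hm hle => ?_).subtype_mk _
    change c m + lag m q.2.1.weight * q.1 = c m
    rw [lag_eq_zero_of_two_mul_above_le q.2.1.weight_nonneg (hpos q hm).1 hle, zero_mul, add_zero]

theorem lineMap_shift_shift_pos (z : Join D.obj) (u : unitInterval) (p : P)
    (hp : 0 < AffineMap.lineMap (k := ℝ) z.weight (shift m (shift m z.weight)) (u : ℝ) p) :
    0 < z.weight p := by
  by_contra! h
  have h' : shift m (shift m z.weight) p ≤ 0 :=
    not_lt.1 fun hpos => (weight_pos_of_shift_shift_pos z p hpos).not_ge h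
  rw [AffineMap.pi_lineMap_apply] at hp
  exact hp.not_ge ((convex_Iic (0 : ℝ)).lineMap_mem h h' u.2)

/-- The self-maps of `colim A c`, for `u` in the unit interval, that move the weights the fraction
`u` of the way to the weights shifted twice to `m`, with the time at `m` unchanged. -/
def partialShift : C(unitInterval × D.colim A c, D.colim A c) where
  toFun q := ⟨retime m (c m) q.2.1
    (AffineMap.lineMap q.2.1.weight (shift m (shift m q.2.1.weight)) (q.1 : ℝ))
    ((convex_stdSimplex ℝ P).lineMap_mem q.2.1.weight_mem
      (shift_mem_stdSimplex (shift_mem_stdSimplex q.2.1.weight_mem)) q.1.2)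
    (lineMap_shift_shift_pos q.2.1 q.1),
    retime_mem_colim hup hlow q.2.2 (fun _ _ => rfl) fun _ _ _ _ => rfl⟩
  continuous_toFun := by
    have hw : Continuous fun q : unitInterval × D.colim A c => q.2.1.weight :=
      continuous_colim_weight.comp continuous_snd
    have hw' := (continuous_shift m).comp ((continuous_shift m).comp hw)
    refine (continuous_retime continuous_snd hup ?_ continuousOn_const
      fun _ _ _ => rfl).subtype_mk _
    simp only [AffineMap.lineMap_apply_module]
    fun_prop

theorem partialShift_zero (z : D.colim A c) : partialShift hup hlow (0, z) = z :=
  Subtype.ext <| (retime_congr rfl (AffineMap.lineMap_apply_zero _ _)).trans (retime_self z.2)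

theorem partialShift_one (z : D.colim A c) :
    partialShift hup hlow (1, z) = doubleShift hup hlow (0, z) :=
  Subtype.ext <| retime_congr (by rw [mul_zero, add_zero]) (AffineMap.lineMap_apply_one _ _)

theorem curry_doubleShift_homotopic_id (d : ℝ) :
    ((doubleShift hup hlow : C(ℝ × D.colim A c, D.colim A c)).curry d).Homotopic
      (ContinuousMap.id _) := by
  let F : C(ℝ × D.colim A c, D.colim A c) := doubleShift hup hlow
  have hdelay : (F.curry 0).Homotopic (F.curry d) := ⟨{
    toContinuousMap := F.comp
      ⟨fun q : unitInterval × D.colim A c => ((q.1 : ℝ) * d, q.2), by fun_prop⟩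
    map_zero_left := fun z => congrArg (fun s => F (s, z)) (zero_mul d)
    map_one_left := fun z => congrArg (fun s => F (s, z)) (one_mul d) }⟩
  have hshift : (ContinuousMap.id _).Homotopic (F.curry 0) := ⟨{
    toContinuousMap := partialShift hup hlow
    map_zero_left := partialShift_zero hup hlow
    map_one_left := partialShift_one hup hlow }⟩
  exact (hshift.trans hdelay).symm

end RoundTrip

section Transfer

variable (hup : ∀ p, m < p → c p = 0) (hlow : ∀ q, q < m → c q = 1)
  (hcc' : ∀ p, p ≠ m → c' p = c p)

/-- The comparison map between the spaces `colim A c` and `colim A c'` for times `c`, `c'` that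
differ only at `m`: the weights are shifted to `m`, so that wherever a point keeps weight above `m`
its weight above `m` used to exceed that of `m`, and the time at `m` has already reached `c' m`. -/
def transfer : C(D.colim A c, D.colim A c') where
  toFun z := ⟨retime m (c m + progress m z.1.weight * (c' m - c m)) z.1 (shift m z.1.weight)
    (shift_mem_stdSimplex z.1.weight_mem) fun _ hp => pos_of_shift_pos z.1.weight_nonneg hp,
    retime_mem_colim hup hlow z.2 hcc' fun p hmp hp hm => by
      rw [progress_eq_one_of_shift_pos z.1.weight_nonneg
        (pos_of_shift_pos z.1.weight_nonneg hm) hmp hp]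
      ring⟩
  continuous_toFun := by
    have hpos : ∀ z : D.colim A c, 0 < shift m z.1.weight m → 0 < z.1.weight m :=
      fun z hm => pos_of_shift_pos z.1.weight_nonneg hm
    refine (continuous_retime continuous_id hup ((continuous_shift m).comp continuous_colim_weight)
      (continuousOn_const.add (((continuousOn_progress m).comp
        continuous_colim_weight.continuousOn hpos).mul continuousOn_const))
      fun z hm hle => ?_).subtype_mk _
    change c m + progress m z.1.weight * (c' m - c m) = c m
    rw [progress_eq_zero (hpos z hm) hle, zero_mul, add_zero]

variable (hup' : ∀ p, m < p → c' p = 0) (hlow' : ∀ q, q < m → c' q = 1)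
  (hc'c : ∀ p, p ≠ m → c p = c' p)

theorem transfer_comp_transfer :
    (transfer hup' hlow' hc'c).comp (transfer hup hlow hcc') =
      (doubleShift hup hlow : C(ℝ × D.colim A c, D.colim A c)).curry (c' m - c m) := by
  refine ContinuousMap.ext fun z => Subtype.ext ?_
  have hnn := z.1.weight_nonneg
  refine retime_retime hup hup' z.2 (transfer hup hlow hcc' z).2 (fun p hmp hp hm => ?_)
    fun hnot hm => ?_
  · rw [lag, progress_eq_one_of_shift_pos hnn (pos_of_shift_pos hnn hm) hmp hp]
    change _ = c' m + progress m (shift m z.1.weight) * (c m - c' m)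
    ring
  · rw [lag, progress_eq_zero_of_forall_not_pos hm hnot, sub_zero]

theorem transfer_comp_transfer_homotopic_id :
    ((transfer hup' hlow' hc'c).comp (transfer hup hlow hcc')).Homotopic
      (ContinuousMap.id (D.colim A c)) := by
  rw [transfer_comp_transfer]
  exact curry_doubleShift_homotopic_id hup hlow _

end Transfer

variable (D A)

theorem nonempty_homotopyEquiv_colim_of_eq_off (hup : ∀ p, m < p → c p = 0)
    (hlow : ∀ q, q < m → c q = 1) (hcc' : ∀ p, p ≠ m → c' p = c p) :
    Nonempty (ContinuousMap.HomotopyEquiv (D.colim A c) (D.colim A c')) :=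
  have hup' : ∀ p, m < p → c' p = 0 := fun p hp => (hcc' p hp.ne').trans (hup p hp)
  have hlow' : ∀ q, q < m → c' q = 1 := fun q hq => (hcc' q hq.ne).trans (hlow q hq)
  have hc'c : ∀ p, p ≠ m → c p = c' p := fun p hp => (hcc' p hp).symm
  ⟨{ toFun := transfer hup hlow hcc'
     invFun := transfer hup' hlow' hc'c
     left_inv := transfer_comp_transfer_homotopic_id hup hlow hcc' hup' hlow' hc'c
     right_inv := transfer_comp_transfer_homotopic_id hup' hlow' hc'c hup hlow hcc' }⟩

theorem nonempty_homotopyEquiv_colim_indicator (S : Finset P) (hS : IsLowerSet (S : Set P)) :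
    Nonempty (ContinuousMap.HomotopyEquiv (D.colim A 0)
      (D.colim A ((S : Set P).indicator 1))) := by
  classical
  induction S using Finset.strongInduction with
  | H S ih =>
    obtain rfl | hne := S.eq_empty_or_nonempty
    · rw [Finset.coe_empty, Set.indicator_empty']
      exact ⟨ContinuousMap.HomotopyEquiv.refl _⟩
    obtain ⟨m, hm⟩ := S.exists_maximal hne
    have hup : ∀ p, m < p → p ∉ S := fun p hp hpS => hp.not_ge (hm.2 hpS hp.le)
    have hlow : ∀ q, q < m → q ∈ S := fun q hq => hS hq.le hm.1
    have hS' : IsLowerSet (S.erase m : Set P) := fun p q hqp hp => by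
      rw [Finset.mem_coe, Finset.mem_erase] at hp ⊢
      refine ⟨?_, hS hqp hp.2⟩
      rintro rfl
      exact hup p (hqp.lt_of_ne' hp.1) hp.2
    obtain ⟨e⟩ := ih _ (Finset.erase_ssubset hm.1) hS'
    obtain ⟨e'⟩ := D.nonempty_homotopyEquiv_colim_of_eq_off A (m := m)
      (c := (S.erase m : Set P).indicator 1) (c' := (S : Set P).indicator 1)
      (fun p hp => by simp [hup p hp]) (fun q hq => by simp [hlow q hq, hq.ne])
      (fun p hp => by simp [Set.indicator_apply, hp])
    exact ⟨e.trans e'⟩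

theorem nonempty_homotopyEquiv_colim_zero_one :
    Nonempty (ContinuousMap.HomotopyEquiv (D.colim A 0) (D.colim A 1)) := by
  have h := D.nonempty_homotopyEquiv_colim_indicator A Finset.univ
    (Finset.coe_univ (α := P) ▸ isLowerSet_univ)
  rwa [Finset.coe_univ, Set.indicator_univ] at h

variable {D}

theorem nonempty_homotopyEquiv_colim_zero {D' : ContractedDiagram.{u} P}
    (e : ∀ p, D.obj p ≃ₜ D'.obj p)
    (he : ∀ ⦃q p⦄ (h : q < p) (x : D.obj p), e q (D.pull h 1 x) = D'.pull h 1 (e p x)) :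
    Nonempty (ContinuousMap.HomotopyEquiv (D.colim A 0) (D'.colim A 0)) := by
  obtain ⟨f⟩ := D.nonempty_homotopyEquiv_colim_zero_one A
  obtain ⟨f'⟩ := D'.nonempty_homotopyEquiv_colim_zero_one A
  exact ⟨(f.trans (colimOneHomeomorph A e he).toHomotopyEquiv).trans f'.symm⟩

end ContractedDiagram

/-! ### Joins of copies of a space over varying index sets -/

/-- The join of copies of `X` indexed by the elements of the set `B` of indices. -/
abbrev SubJoin {ι : Type v} [Fintype ι] (X : Type u) (B : Set ι) : Type (max u v) :=
  Join fun i : ι => {_x : X // i ∈ B}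

namespace SubJoin

variable {X : Type u} {ι : Type v} [Fintype ι] {ι' : Type w} [Fintype ι'] {B C : Set ι}
  {B' : Set ι'}

theorem mem_of_weight_pos (x : SubJoin X B) {i : ι} (h : 0 < x.weight i) : i ∈ B :=
  (x.point i h).2

/-- The point of `SubJoin X B` given by a point of the join over all indices. -/
def restrict (x : Join fun _ : ι => X) (h : ∀ ⦃i⦄, 0 < x.weight i → i ∈ B) : SubJoin X B where
  weight := x.weight
  weight_mem := x.weight_mem
  point i hi := ⟨x.point i hi, h hi⟩

/-- The inclusion into the join over all indices. -/
def forget (x : SubJoin X B) : Join fun _ : ι => X := Join.map (fun _ y => y.1) x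

/-- The map that moves the factor with index `σ i` to the index `i`. -/
def reindex (σ : ι' ≃ ι) (h : ∀ i, σ i ∈ B → i ∈ B') (x : SubJoin X B) : SubJoin X B' where
  weight i := x.weight (σ i)
  weight_mem := ⟨fun _ => x.weight_nonneg _, (σ.sum_comp x.weight).trans x.sum_weight⟩
  point i hi := ⟨(x.point (σ i) hi).1, h i (x.point (σ i) hi).2⟩

theorem reindex_symm_reindex (σ : ι' ≃ ι) (h : ∀ i, σ i ∈ B → i ∈ B')
    (h' : ∀ i, σ.symm i ∈ B' → i ∈ B) (x : SubJoin X B) :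
    reindex σ.symm h' (reindex σ h x) = x := by
  refine Join.ext (fun i => congrArg x.weight (σ.apply_symm_apply i)) fun i hi hi' => ?_
  have hpoint : ∀ j hj, j = i → (x.point j hj).1 = (x.point i hi').1 := by
    rintro j _ rfl
    rfl
  exact Subtype.ext (hpoint _ hi (σ.apply_symm_apply i))

/-- The barycenter, with all recorded points equal to `x₀`. -/
def barycenter (x₀ : X) (hC : C.Nonempty) : SubJoin X C :=
  Join.normalize (C.indicator 1) (Set.indicator_nonneg fun _ _ => zero_le_one)
    (Finset.sum_pos' (fun _ _ => Set.indicator_nonneg (fun _ _ => zero_le_one) _)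
      ⟨hC.some, Finset.mem_univ _, by simp [hC.some_mem]⟩)
    fun _ hi => ⟨x₀, Set.mem_of_indicator_ne_zero hi.ne'⟩

theorem reindex_barycenter (σ : ι' ≃ ι) (h : ∀ i, i ∈ B' ↔ σ i ∈ B) (x₀ : X) (hB : B.Nonempty)
    (hB' : B'.Nonempty) : reindex σ (fun i => (h i).2) (barycenter x₀ hB) = barycenter x₀ hB' := by
  classical
  have hind : ∀ i, B.indicator (1 : ι → ℝ) (σ i) = B'.indicator 1 i := fun i => by
    simp only [Set.indicator_apply, h, Pi.one_apply]
  refine Join.ext (fun i => ?_) fun _ _ _ => rfl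
  refine congrArg₂ (· / ·) (hind i) ?_
  rw [← σ.sum_comp]
  exact Finset.sum_congr rfl fun i _ => hind i

/-- The unnormalized weights of `contract`. -/
def contractWeight (C : Set ι) (t : ℝ) (x : SubJoin X B) : ι → ℝ :=
  C.indicator fun i => abs ((1 - t) * x.weight i - |t|)

theorem contractWeight_nonneg (t : ℝ) (x : SubJoin X B) (i : ι) : 0 ≤ contractWeight C t x i :=
  Set.indicator_nonneg (fun _ _ => abs_nonneg _) i

theorem mem_of_contractWeight_pos {t : ℝ} {x : SubJoin X B} {i : ι}
    (h : 0 < contractWeight C t x i) : i ∈ C :=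
  Set.mem_of_indicator_ne_zero h.ne'

theorem contractWeight_zero (h : B ⊆ C) (x : SubJoin X B) : contractWeight C 0 x = x.weight := by
  ext i
  by_cases hi : i ∈ C
  · simp [contractWeight, hi, x.weight_nonneg i]
  · have hxi := (x.weight_nonneg i).eq_of_not_lt' fun hpos => hi (h (x.mem_of_weight_pos hpos))
    simp [contractWeight, hi, hxi]

theorem contractWeight_one (x : SubJoin X B) : contractWeight C 1 x = C.indicator 1 := by
  simp [contractWeight, Pi.one_def]

theorem sum_contractWeight_pos (h : B ⊂ C) (t : ℝ) (x : SubJoin X B) :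
    0 < ∑ i, contractWeight C t x i := by
  obtain rfl | ht := eq_or_ne t 0
  · rw [contractWeight_zero h.subset, x.sum_weight]
    exact one_pos
  · obtain ⟨i, hiC, hiB⟩ := Set.exists_of_ssubset h
    have hxi := (x.weight_nonneg i).eq_of_not_lt' fun hpos => hiB (x.mem_of_weight_pos hpos)
    refine Finset.sum_pos' (fun i _ => contractWeight_nonneg t x i) ⟨i, Finset.mem_univ i, ?_⟩
    simpa [contractWeight, hiC, hxi] using ht

theorem weight_pos_of_abs_lt {t : ℝ} {x : SubJoin X B} {i : ι}
    (h : |t| < (1 - t) * x.weight i) : 0 < x.weight i := by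
  refine (x.weight_nonneg i).lt_of_ne' fun h' => ?_
  rw [h', mul_zero] at h
  exact h.not_ge (abs_nonneg t)

open Classical in
/-- The point with index `i` of `contract`. -/
def contractPoint (x₀ : X) (t : ℝ) (x : SubJoin X B) (i : ι) : X :=
  if h : |t| < (1 - t) * x.weight i then (x.point i (weight_pos_of_abs_lt h)).1 else x₀

theorem contractPoint_of_lt (x₀ : X) {t : ℝ} {x : SubJoin X B} {i : ι}
    (h : |t| < (1 - t) * x.weight i) :
    contractPoint x₀ t x i = (x.point i (weight_pos_of_abs_lt h)).1 :=
  dif_pos h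

theorem contractPoint_of_not_lt (x₀ : X) {t : ℝ} {x : SubJoin X B} {i : ι}
    (h : ¬ |t| < (1 - t) * x.weight i) : contractPoint x₀ t x i = x₀ :=
  dif_neg h

/-- A null-homotopy of the inclusion of `SubJoin X B` into a join `SubJoin X C` over a strictly
larger index set. The weights first decrease to zero; the factors are then refilled with the point
`x₀`. The factors outside `B` ensure that the weights never vanish simultaneously. -/
def contract (x₀ : X) (h : B ⊂ C) (t : ℝ) (x : SubJoin X B) : SubJoin X C :=
  Join.normalize (contractWeight C t x) (contractWeight_nonneg t x) (sum_contractWeight_pos h t x)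
    fun i hi => ⟨contractPoint x₀ t x i, mem_of_contractWeight_pos hi⟩

theorem contract_zero (x₀ : X) (h : B ⊂ C) (x : SubJoin X B) :
    contract x₀ h 0 x = Join.map (fun _ y => ⟨y.1, h.subset y.2⟩) x := by
  refine Join.ext (fun i => ?_) fun i hi hi' => Subtype.ext (contractPoint_of_lt x₀ ?_)
  · simp only [contract, Join.normalize, Join.map, contractWeight_zero h.subset, x.sum_weight,
      div_one]
  · simpa using (show 0 < x.weight i from hi')

theorem contract_one (x₀ : X) (h : B ⊂ C) (hC : C.Nonempty) (x : SubJoin X B) :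
    contract x₀ h 1 x = barycenter x₀ hC := by
  refine Join.ext (fun i => ?_) fun i hi hi' => Subtype.ext (contractPoint_of_not_lt x₀ ?_)
  · simp only [contract, Join.normalize, barycenter, contractWeight_one]
  · simp

variable [TopologicalSpace X]

theorem continuous_contractWeight (i : ι) :
    Continuous fun q : ℝ × SubJoin X B => contractWeight C q.1 q.2 i := by
  have hsnd : Continuous (Prod.snd : ℝ × SubJoin X B → _) := continuous_snd
  have := Join.continuous_weight_comp hsnd i
  by_cases hi : i ∈ C
  · simp only [contractWeight, Set.indicator_of_mem hi]
    fun_prop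
  · simp only [contractWeight, Set.indicator_of_notMem hi]
    exact continuous_const

theorem continuous_contract (x₀ : X) (h : B ⊂ C) :
    Continuous fun q : ℝ × SubJoin X B => contract x₀ h q.1 q.2 := by
  refine Join.continuous_normalize continuous_contractWeight fun i => ?_
  refine Continuous.subtype_mk (continuous_of_exists_isOpen fun y => ?_) _
  let Y := {q : ℝ × SubJoin X B // 0 < contractWeight C q.1 q.2 i}
  have hx : Continuous fun q : Y => q.1.2 := continuous_snd.comp continuous_subtype_val
  have hw : Continuous fun q : Y => (1 - q.1.1) * q.1.2.weight i :=
    (continuous_const.sub (continuous_fst.comp continuous_subtype_val)).mul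
      (Join.continuous_weight_comp hx i)
  have ht : Continuous fun q : Y => |q.1.1| := (continuous_fst.comp continuous_subtype_val).abs
  obtain hlt | hge := lt_or_ge |y.1.1| ((1 - y.1.1) * y.1.2.weight i)
  · refine ⟨{q | |q.1.1| < (1 - q.1.1) * q.1.2.weight i}, isOpen_lt ht hw, hlt, ?_⟩
    refine (continuous_subtype_val.comp (Join.continuous_point_comp
      (hx.comp continuous_subtype_val) i fun v => weight_pos_of_abs_lt v.2)).congr fun v => ?_
    exact (contractPoint_of_lt x₀ v.2).symm
  · have hne : ∀ q : Y, (1 - q.1.1) * q.1.2.weight i ≠ |q.1.1| := fun q heq => by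
      have := q.2
      simp [contractWeight, Set.indicator_of_mem (mem_of_contractWeight_pos this), heq] at this
    refine ⟨{q | (1 - q.1.1) * q.1.2.weight i < |q.1.1|}, isOpen_lt hw ht,
      lt_of_le_of_ne hge (hne y), (continuous_const (y := x₀)).congr fun v => ?_⟩
    exact (contractPoint_of_not_lt x₀ (lt_asymm v.2)).symm

theorem continuous_forget : Continuous (forget : SubJoin X B → _) :=
  Join.continuous_map fun _ => continuous_subtype_val

theorem continuous_restrict {Y : Type*} [TopologicalSpace Y] {f : Y → Join fun _ : ι => X}
    (hf : Continuous f) (h : ∀ y ⦃i⦄, 0 < (f y).weight i → i ∈ B) :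
    Continuous fun y => restrict (f y) (h y) :=
  Join.continuous_of (fun i => Join.continuous_weight_comp hf i) fun i =>
    (Join.continuous_point_comp (hf.comp continuous_subtype_val) i fun y => y.2).subtype_mk _

theorem continuous_reindex (σ : ι' ≃ ι) (h : ∀ i, σ i ∈ B → i ∈ B') :
    Continuous (reindex σ h : SubJoin X B → SubJoin X B') :=
  Join.continuous_of (fun i => Join.continuous_weight (σ i)) fun i =>
    (continuous_subtype_val.comp (Join.continuous_point (σ i))).subtype_mk _

/-- The homeomorphism that permutes the factors of a join according to a bijection of the index
sets. -/
def reindexHomeomorph (σ : ι' ≃ ι) (h : ∀ i, i ∈ B' ↔ σ i ∈ B) : SubJoin X B ≃ₜ SubJoin X B' :=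
  have h' : ∀ i, σ.symm i ∈ B' → i ∈ B := fun i hi => by simpa using (h _).1 hi
  { toFun := reindex σ fun i => (h i).2
    invFun := reindex σ.symm h'
    left_inv := reindex_symm_reindex σ _ h'
    right_inv := reindex_symm_reindex σ.symm h' _
    continuous_toFun := continuous_reindex σ _
    continuous_invFun := continuous_reindex σ.symm h' }

end SubJoin

/-! ### Homotopy colimits of diagrams of joins -/

section OrderComplex

variable {P : Type v} [PartialOrder P] [Fintype P] {ι ι' : Type w} [Fintype ι]
  [Fintype ι'] (X : Type u) (A : Set P)

/-- The geometric realization, in barycentric coordinates, of the order complex of a subset `A` of a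
finite poset. -/
def orderComplex : Set (P → ℝ) :=
  {b | b ∈ stdSimplex ℝ P ∧ (∀ p, 0 < b p → p ∈ A) ∧ IsChain (· ≤ ·) {p | 0 < b p}}

/-- The homotopy colimit, over the elements of `A`, of the diagram of the joins `SubJoin X (l p)`
and their inclusions, embedded in the product of the order complex with the join over all
indices. -/
def realization (l : P → Set ι) : Set ((P → ℝ) × Join fun _ : ι => X) :=
  {y | y.1 ∈ orderComplex A ∧ ∀ p, 0 < y.1 p → ∀ ⦃i⦄, 0 < y.2.weight i → i ∈ l p}

variable {X} [TopologicalSpace X] {l' : P → Set ι'} {l : P → Set ι}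

/-- The diagram of the joins `SubJoin X (l p)`, for `l` strictly antitone, contracted to the
barycenters. -/
def subJoinDiagram (x₀ : X) (hl : StrictAnti l) : ContractedDiagram P where
  obj p := SubJoin X (l p)
  pull h := SubJoin.contract x₀ (hl h)
  continuous_pull h := SubJoin.continuous_contract x₀ (hl h)
  pull_pull_zero h h' t x := by
    rw [SubJoin.contract_zero]
    rfl
  pull_one h h' x y := by
    have hne := Set.nonempty_of_ssubset' (hl h)
    rw [SubJoin.contract_one x₀ _ hne, SubJoin.contract_one x₀ _ hne]

variable {A}

theorem forget_point_eq {x₀ : X} {hl : StrictAnti l} {z : Join (subJoinDiagram x₀ hl).obj}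
    (hz : z ∈ (subJoinDiagram x₀ hl).colim A 0) {p q : P} (hp : 0 < z.weight p)
    (hq : 0 < z.weight q) : SubJoin.forget (z.point p hp) = SubJoin.forget (z.point q hq) := by
  wlog hpq : p ≤ q generalizing p q
  · exact (this hq hp ((hz.2.1.total hp hq).resolve_left hpq)).symm
  obtain rfl | hlt := hpq.eq_or_lt
  · rfl
  · rw [hz.2.2 hlt hp hq]
    exact congrArg SubJoin.forget (SubJoin.contract_zero x₀ (hl hlt) _)

theorem continuous_forget_point {x₀ : X} {hl : StrictAnti l}
    (s : ∀ z : (subJoinDiagram x₀ hl).colim A 0, {p // 0 < z.1.weight p}) :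
    Continuous fun z : (subJoinDiagram x₀ hl).colim A 0 =>
      SubJoin.forget (z.1.point (s z).1 (s z).2) := by
  refine continuous_of_exists_isOpen fun z => ⟨{z' | 0 < z'.1.weight (s z).1},
    isOpen_lt continuous_const (Join.continuous_weight_comp continuous_subtype_val _), (s z).2, ?_⟩
  have hpoint := Join.continuous_point_comp
    (continuous_subtype_val.comp continuous_subtype_val) (s z).1
    fun v : {z' : (subJoinDiagram x₀ hl).colim A 0 | 0 < z'.1.weight (s z).1} => v.2
  exact (SubJoin.continuous_forget.comp hpoint).congr fun v => forget_point_eq v.1.2 _ _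

variable (A) in
/-- The two models of the homotopy colimit of a diagram of joins. -/
def realizationHomeomorph (x₀ : X) (hl : StrictAnti l) :
    realization X A l ≃ₜ (subJoinDiagram x₀ hl).colim A 0 where
  toFun y := ⟨⟨y.1.1, y.2.1.1, fun p hp => SubJoin.restrict y.1.2 (y.2.2 p hp)⟩,
    y.2.1.2.1, y.2.1.2.2, fun _ p h _ hp =>
      (SubJoin.contract_zero x₀ (hl h) (SubJoin.restrict y.1.2 (y.2.2 p hp))).symm⟩
  invFun z :=
    have hpos := exists_pos_of_mem_stdSimplex z.1.weight_mem
    ⟨(z.1.weight, SubJoin.forget (z.1.point hpos.choose hpos.choose_spec)),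
      ⟨z.1.weight_mem, z.2.1, z.2.2.1⟩, fun p hp i hi => by
        rw [forget_point_eq z.2 _ hp] at hi
        exact SubJoin.mem_of_weight_pos (z.1.point p hp) hi⟩
  left_inv _ := rfl
  right_inv z := by
    refine Subtype.ext (Join.ext (fun _ => rfl) fun p _ hp => ?_)
    refine Eq.trans (b := SubJoin.restrict (SubJoin.forget (z.1.point p hp))
      fun i => SubJoin.mem_of_weight_pos (z.1.point p hp)) ?_ rfl
    simp only [forget_point_eq z.2 _ hp]
  continuous_toFun :=
    (Join.continuous_of (fun p => (continuous_apply p).comp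
      (continuous_fst.comp continuous_subtype_val)) fun p => SubJoin.continuous_restrict
        (continuous_snd.comp (continuous_subtype_val.comp continuous_subtype_val)) _).subtype_mk _
  continuous_invFun :=
    (ContractedDiagram.continuous_colim_weight.prodMk (continuous_forget_point fun z =>
      ⟨_, (exists_pos_of_mem_stdSimplex z.1.weight_mem).choose_spec⟩)).subtype_mk _

variable (X A)

theorem nonempty_homotopyEquiv_realization (hl : StrictAnti l) (hl' : StrictAnti l')
    (h : ∀ p, ∃ σ : ι' ≃ ι, ∀ i, i ∈ l' p ↔ σ i ∈ l p) :
    Nonempty (ContinuousMap.HomotopyEquiv (realization X A l) (realization X A l')) := by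
  choose σ hσ using h
  obtain hX | ⟨⟨x₀⟩⟩ := isEmpty_or_nonempty X
  · have : IsEmpty (realization X A l) := ⟨fun y => Join.isEmpty.false y.1.2⟩
    have : IsEmpty (realization X A l') := ⟨fun y => Join.isEmpty.false y.1.2⟩
    exact ⟨Homeomorph.empty.toHomotopyEquiv⟩
  · obtain ⟨e⟩ := ContractedDiagram.nonempty_homotopyEquiv_colim_zero A
      (D := subJoinDiagram x₀ hl) (D' := subJoinDiagram x₀ hl')
      (fun p => SubJoin.reindexHomeomorph (σ p) (hσ p)) fun q p hqp x => by
        have hne := Set.nonempty_of_ssubset' (hl hqp)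
        have hne' := Set.nonempty_of_ssubset' (hl' hqp)
        have hbar := SubJoin.reindex_barycenter (σ q) (hσ q) x₀ hne hne'
        rw [← SubJoin.contract_one x₀ (hl hqp) hne x] at hbar
        exact hbar.trans (SubJoin.contract_one x₀ (hl' hqp) hne' _).symm
    exact ⟨((realizationHomeomorph A x₀ hl).toHomotopyEquiv.trans e).trans
      (realizationHomeomorph A x₀ hl').symm.toHomotopyEquiv⟩

end OrderComplex

/-! ### Iterated joins -/

section Scaled

variable {Y V : Type*} [TopologicalSpace Y] [NormedAddCommGroup V] [NormedSpace ℝ V]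

open Classical in
/-- The product `k • φ`, where `φ` is defined only if `0 < k`. -/
def scaled (k : ℝ) (φ : 0 < k → V) : V := if h : 0 < k then k • φ h else 0

theorem scaled_of_pos {k : ℝ} {φ : 0 < k → V} (h : 0 < k) : scaled k φ = k • φ h := dif_pos h

theorem scaled_of_not_pos {k : ℝ} {φ : 0 < k → V} (h : ¬ 0 < k) : scaled k φ = 0 := dif_neg h

theorem norm_scaled_le {k C : ℝ} {φ : 0 < k → V} (hφ : ∀ h, ‖φ h‖ ≤ C) :
    ‖scaled k φ‖ ≤ |k| * |C| := by
  by_cases h : 0 < k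
  · rw [scaled_of_pos h, norm_smul, Real.norm_eq_abs]
    gcongr
    exact (hφ h).trans (le_abs_self C)
  · rw [scaled_of_not_pos h, norm_zero]
    positivity

theorem scaled_nonneg {k : ℝ} {φ : 0 < k → ℝ} (hφ : ∀ h, 0 ≤ φ h) : 0 ≤ scaled k φ := by
  unfold scaled
  split_ifs with h
  exacts [mul_nonneg h.le (hφ h), le_rfl]

theorem continuous_scaled {k : Y → ℝ} (hk : Continuous k) (h0 : ∀ y, 0 ≤ k y) {C : ℝ}
    {φ : ∀ y, 0 < k y → V} (hC : ∀ y h, ‖φ y h‖ ≤ C)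
    (hφ : Continuous fun y : {y // 0 < k y} => φ y.1 y.2) :
    Continuous fun y => scaled (k y) (φ y) := by
  rw [continuous_iff_continuousAt]
  intro y
  obtain h | h := (h0 y).lt_or_eq
  · have : ContinuousOn (fun y => scaled (k y) (φ y)) {y | 0 < k y} := by
      rw [continuousOn_iff_continuous_domRestrict]
      exact ((hk.comp continuous_subtype_val).smul hφ).congr fun v => (scaled_of_pos v.2).symm
    exact this.continuousAt ((isOpen_lt continuous_const hk).mem_nhds h)
  · rw [ContinuousAt, scaled_of_not_pos h.not_lt]
    refine squeeze_zero_norm (fun v => norm_scaled_le (hC v)) ?_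
    have : Continuous fun v => |k v| * |C| := hk.abs.mul continuous_const
    simpa [← h] using this.tendsto y

theorem scaled_pos_iff {k : ℝ} {φ : 0 < k → ℝ} : 0 < scaled k φ ↔ ∃ h, 0 < φ h := by
  by_cases h : 0 < k
  · rw [scaled_of_pos h, smul_eq_mul, mul_pos_iff_of_pos_left h]
    exact ⟨fun h' => ⟨h, h'⟩, fun ⟨_, h'⟩ => h'⟩
  · rw [scaled_of_not_pos h]
    exact ⟨fun h' => absurd h' (lt_irrefl 0), fun ⟨h', _⟩ => absurd h' h⟩

end Scaled

namespace Join

variable {ι : Type v} [Fintype ι] {κ : ι → Type w} [∀ i, Fintype (κ i)]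
  {Z : (Σ i, κ i) → Type u}

theorem weight_le_one {Z : ι → Type u} (z : Join Z) (i : ι) : z.weight i ≤ 1 :=
  (Finset.single_le_sum (fun j _ => z.weight_nonneg j) (Finset.mem_univ i)).trans_eq z.sum_weight

/-- The point of an iterated join obtained by grouping the terms of a convex combination. -/
def curry (x : Join Z) : Join fun i => Join fun j => Z ⟨i, j⟩ where
  weight i := ∑ j, x.weight ⟨i, j⟩
  weight_mem := ⟨fun _ => Finset.sum_nonneg fun _ _ => x.weight_nonneg _, by
    rw [← Fintype.sum_sigma', ← x.sum_weight]⟩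
  point i h := normalize (fun j => x.weight ⟨i, j⟩) (fun _ => x.weight_nonneg _) h
    fun j => x.point ⟨i, j⟩

theorem sum_scaled_weight (z : Join fun i => Join fun j => Z ⟨i, j⟩) (i : ι) :
    ∑ j, scaled (z.weight i) (fun h => (z.point i h).weight j) = z.weight i := by
  obtain h | h := (z.weight_nonneg i).lt_or_eq
  · simp only [scaled_of_pos h, smul_eq_mul, ← Finset.mul_sum, sum_weight, mul_one]
  · exact (Finset.sum_eq_zero fun _ _ => scaled_of_not_pos h.not_lt).trans h

/-- The convex combination obtained by expanding a convex combination of points of joins. -/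
def uncurry (z : Join fun i => Join fun j => Z ⟨i, j⟩) : Join Z where
  weight p := scaled (z.weight p.1) fun h => (z.point p.1 h).weight p.2
  weight_mem := by
    refine ⟨fun p => scaled_nonneg fun _ => weight_nonneg _ _, ?_⟩
    rw [Fintype.sum_sigma]
    simp only [sum_scaled_weight, sum_weight]
  point p h := (z.point p.1 (scaled_pos_iff.1 h).1).point p.2 (scaled_pos_iff.1 h).2

theorem uncurry_curry (x : Join Z) : uncurry (curry x) = x := by
  refine ext (fun p => ?_) fun _ _ _ => rfl
  change scaled (∑ j, x.weight ⟨p.1, j⟩) (fun _ => x.weight p / ∑ j, x.weight ⟨p.1, j⟩) = _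
  obtain h | h : 0 < ∑ j, x.weight ⟨p.1, j⟩ ∨ 0 = ∑ j, x.weight ⟨p.1, j⟩ :=
    ((curry x).weight_nonneg p.1).lt_or_eq
  · rw [scaled_of_pos h, smul_eq_mul, mul_div_cancel₀ _ h.ne']
  · rw [scaled_of_not_pos h.not_lt]
    exact ((Finset.sum_eq_zero_iff_of_nonneg fun j _ => x.weight_nonneg ⟨p.1, j⟩).1 h.symm p.2
      (Finset.mem_univ _)).symm

theorem weight_pos_iff (x : Join Z) (p : Σ i, κ i) :
    0 < x.weight p ↔ ∃ h : 0 < x.curry.weight p.1, 0 < (x.curry.point p.1 h).weight p.2 := by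
  conv_lhs => rw [← uncurry_curry x]
  exact scaled_pos_iff

theorem curry_uncurry (z : Join fun i => Join fun j => Z ⟨i, j⟩) : curry (uncurry z) = z := by
  refine ext (sum_scaled_weight z) fun i _ h => ext (fun j => ?_) fun _ _ _ => rfl
  change scaled (z.weight i) (fun h => (z.point i h).weight j) / ∑ j, scaled (z.weight i) _ = _
  rw [sum_scaled_weight, scaled_of_pos h, smul_eq_mul, mul_div_cancel_left₀ _ h.ne']

variable [∀ p, TopologicalSpace (Z p)]

theorem continuous_curry : Continuous (curry : Join Z → _) :=
  continuous_of (fun _ => continuous_finsetSum _ fun _ _ => continuous_weight _) fun i =>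
    continuous_normalize (h0 := fun y j => y.1.weight_nonneg ⟨i, j⟩) (h1 := fun y => y.2)
      (fun _ => continuous_weight_comp continuous_subtype_val _) fun _ =>
      continuous_point_comp (continuous_subtype_val.comp continuous_subtype_val) _ fun y => y.2

theorem continuous_uncurry :
    Continuous (uncurry : (Join fun i => Join fun j => Z ⟨i, j⟩) → Join Z) := by
  refine continuous_of (fun p => ?_) fun p => ?_
  · refine continuous_scaled (C := 1) (continuous_weight p.1) (fun z => z.weight_nonneg _)
      (fun z h => ?_) (continuous_weight_comp (continuous_point p.1) p.2)
    rw [Real.norm_of_nonneg (weight_nonneg _ _)]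
    exact weight_le_one _ _
  · exact continuous_point_comp (continuous_point_comp continuous_subtype_val p.1
      fun y => (scaled_pos_iff.1 y.2).1) p.2 fun y => (scaled_pos_iff.1 y.2).2

/-- Associativity of the join. -/
def sigmaHomeomorph (Z : (Σ i, κ i) → Type u) [∀ p, TopologicalSpace (Z p)] :
    Join Z ≃ₜ Join fun i => Join fun j => Z ⟨i, j⟩ where
  toFun := curry
  invFun := uncurry
  left_inv := uncurry_curry
  right_inv := curry_uncurry
  continuous_toFun := continuous_curry
  continuous_invFun := continuous_uncurry

end Join

/-! ### Fibrewise joins -/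

namespace BinaryJoin

variable {A : Type u} {B : Type v} {r : ℝ}

/-- The point `(1 - r) a + r b` of the join of two spaces. -/
def mk (hr : r ∈ unitInterval) (a : r < 1 → A) (b : 0 < r → B) : BinaryJoin A B where
  weight c := cond c r (1 - r)
  weight_mem := ⟨fun c => by cases c; exacts [sub_nonneg.2 hr.2, hr.1], by simp⟩
  point
    | false => fun h => ULift.up (a (sub_pos.1 h))
    | true => fun h => ULift.up (b h)

theorem weight_false (z : BinaryJoin A B) : z.weight false = 1 - z.weight true := by
  linarith [z.sum_weight, Fintype.sum_bool z.weight]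

theorem weight_true_mem (z : BinaryJoin A B) : z.weight true ∈ unitInterval :=
  ⟨z.weight_nonneg true, z.weight_le_one true⟩

/-- The point of the first space. -/
def left (z : BinaryJoin A B) (h : z.weight true < 1) : A :=
  (show ULift A from z.point false (by rw [z.weight_false]; exact sub_pos.2 h)).down

/-- The point of the second space. -/
def right (z : BinaryJoin A B) (h : 0 < z.weight true) : B :=
  (show ULift B from z.point true h).down

theorem ext {z w : BinaryJoin A B} (h : z.weight true = w.weight true)
    (hl : ∀ h h', z.left h = w.left h') (hr : ∀ h h', z.right h = w.right h') : z = w := by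
  refine Join.ext (fun c => ?_) fun c hz hw => ?_
  · cases c
    exacts [by rw [weight_false, weight_false, h], h]
  · cases c
    · exact ULift.ext _ _ (hl (by linarith [z.weight_false]) (by linarith [w.weight_false]))
    · exact ULift.ext _ _ (hr hz hw)

variable [TopologicalSpace A] [TopologicalSpace B] {Y : Type*} [TopologicalSpace Y]

theorem continuous_mk {r : Y → ℝ} {hr : ∀ y, r y ∈ unitInterval} {a : ∀ y, r y < 1 → A}
    {b : ∀ y, 0 < r y → B} (hrc : Continuous r)
    (ha : Continuous fun y : {y // r y < 1} => a y.1 y.2)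
    (hb : Continuous fun y : {y // 0 < r y} => b y.1 y.2) :
    Continuous fun y => mk (hr y) (a y) (b y) := by
  refine Join.continuous_of (fun c => ?_) fun c => ?_
  · cases c
    exacts [continuous_const.sub hrc, hrc]
  · cases c
    · have : Continuous fun y : {y // 0 < (mk (hr y) (a y) (b y)).weight false} =>
          (⟨y.1, sub_pos.1 y.2⟩ : {y // r y < 1}) := continuous_subtype_val.subtype_mk _
      exact continuous_uliftUp.comp (ha.comp this)
    · exact continuous_uliftUp.comp hb

theorem continuous_left {f : Y → BinaryJoin A B} (hf : Continuous f)
    (h : ∀ y, (f y).weight true < 1) : Continuous fun y => (f y).left (h y) :=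
  continuous_uliftDown.comp (Join.continuous_point_comp hf false _)

theorem continuous_right {f : Y → BinaryJoin A B} (hf : Continuous f)
    (h : ∀ y, 0 < (f y).weight true) : Continuous fun y => (f y).right (h y) :=
  continuous_uliftDown.comp (Join.continuous_point_comp hf true h)

/-- The homeomorphism of joins induced by a homeomorphism of the second factors. -/
def congrRight (A : Type u) [TopologicalSpace A] {C : Type v} [TopologicalSpace C] (e : B ≃ₜ C) :
    BinaryJoin A B ≃ₜ BinaryJoin A C :=
  Join.homeomorph fun
    | false => Homeomorph.refl (ULift A)
    | true => (Homeomorph.ulift.trans e).trans Homeomorph.ulift.symm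

/-- The linear homotopy, with parameter `u`, from `r` to a function which vanishes near `r = 0`. -/
def squeezedWeight (u r : ℝ) : ℝ := (1 - u) * r + u * max 0 (2 * r - 1)

theorem continuous_squeezedWeight : Continuous fun q : ℝ × ℝ => squeezedWeight q.1 q.2 := by
  unfold squeezedWeight
  fun_prop

theorem squeezedWeight_mem {u : ℝ} (hu : u ∈ unitInterval) (hr : r ∈ unitInterval) :
    squeezedWeight u r ∈ unitInterval := by
  have hmax : max 0 (2 * r - 1) ∈ unitInterval :=
    ⟨le_max_left _ _, max_le zero_le_one (by linarith [hr.2])⟩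
  exact (convex_Icc 0 1) hr hmax (sub_nonneg.2 hu.2) hu.1 (sub_add_cancel 1 u)

theorem pos_of_squeezedWeight_pos {u : ℝ} (hr : r ∈ unitInterval)
    (h : 0 < squeezedWeight u r) : 0 < r := by
  refine hr.1.lt_of_ne fun h0 => ?_
  norm_num [squeezedWeight, ← h0] at h

theorem lt_one_of_squeezedWeight_lt_one {u : ℝ} (hr : r ∈ unitInterval)
    (h : squeezedWeight u r < 1) : r < 1 := by
  refine hr.2.lt_of_ne fun h1 => ?_
  norm_num [squeezedWeight, h1] at h

theorem squeezedWeight_zero : squeezedWeight 0 r = r := by simp [squeezedWeight]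

theorem two_mul_gt_one_of_squeezedWeight_one_pos (h : 0 < squeezedWeight 1 r) : 1 < 2 * r := by
  simpa [squeezedWeight] using h

/-- The self-homotopy of a join, starting at the identity, that moves a neighbourhood of the first
factor into the first factor. -/
def squeeze : C(unitInterval × BinaryJoin A B, BinaryJoin A B) where
  toFun q := mk (squeezedWeight_mem q.1.2 q.2.weight_true_mem)
    (fun h => q.2.left (lt_one_of_squeezedWeight_lt_one q.2.weight_true_mem h))
    fun h => q.2.right (pos_of_squeezedWeight_pos q.2.weight_true_mem h)
  continuous_toFun := by
    have hsnd : Continuous (Prod.snd : unitInterval × BinaryJoin A B → _) := continuous_snd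
    refine continuous_mk (continuous_squeezedWeight.comp ((continuous_subtype_val.comp
      continuous_fst).prodMk (Join.continuous_weight_comp hsnd true))) ?_ ?_
    exacts [continuous_left (hsnd.comp continuous_subtype_val) _,
      continuous_right (hsnd.comp continuous_subtype_val) _]

theorem squeeze_zero (z : BinaryJoin A B) : squeeze (0, z) = z :=
  ext squeezedWeight_zero (fun _ _ => rfl) fun _ _ => rfl

end BinaryJoin

section FiberJoin

variable (E : Type u) {Y : Type v} {V : Type w} (S : Set V) (R : Set (V × Y))

/-- The union, over the points `b` of `S`, of the joins of `E` with the fibres over `b` of a space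
`R` over `S`. -/
def fiberJoin : Set (V × BinaryJoin E Y) :=
  {q | q.1 ∈ S ∧ ∀ h : 0 < q.2.weight true, (q.1, q.2.right h) ∈ R}

variable {E S R} [NormedAddCommGroup V] [NormedSpace ℝ V] {t : V}

/-- The point of `S` over which `fiberJoinExpand` puts a point: it moves from `t` to the point
recorded by the second factor while the weight of the latter increases from `0` to `1 / 2`. -/
def expandBase (t : V) (z : BinaryJoin E R) : V :=
  t + scaled (min 1 (2 * z.weight true)) fun h =>
    (z.right (by simpa using (lt_min_iff.1 h).2)).1.1 - t

theorem expandBase_of_pos {z : BinaryJoin E R} (h : 0 < z.weight true) :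
    expandBase t z = t + min 1 (2 * z.weight true) • ((z.right h).1.1 - t) := by
  rw [expandBase, scaled_of_pos (lt_min one_pos (by positivity))]

theorem expandBase_of_not_pos {z : BinaryJoin E R} (h : ¬ 0 < z.weight true) :
    expandBase t z = t := by
  rw [expandBase, scaled_of_not_pos (by simpa using h), add_zero]

theorem expandBase_of_squeezedWeight_pos {z : BinaryJoin E R}
    (h : 0 < BinaryJoin.squeezedWeight 1 (z.weight true)) (h' : 0 < z.weight true) :
    expandBase t z = (z.right h').1.1 := by
  rw [expandBase_of_pos h',
    min_eq_left (BinaryJoin.two_mul_gt_one_of_squeezedWeight_one_pos h).le, one_smul,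
    add_sub_cancel]

theorem expandBase_mem (hS : StarConvex ℝ t S) (ht : t ∈ S) (hR : ∀ q ∈ R, q.1 ∈ S)
    (z : BinaryJoin E R) : expandBase t z ∈ S := by
  by_cases h : 0 < z.weight true
  · rw [expandBase_of_pos h]
    exact hS.add_smul_sub_mem (hR _ (z.right h).2) (by positivity) (min_le_left _ _)
  · rwa [expandBase_of_not_pos h]

variable [TopologicalSpace E] [TopologicalSpace Y]

variable (E S R) in
/-- The quotient map collapsing `S` in the subspace `S × E` of the fibrewise join. -/
def fiberJoinCollapse : C(fiberJoin E S R, BinaryJoin E R) where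
  toFun q := BinaryJoin.mk q.1.2.weight_true_mem q.1.2.left fun h =>
    ⟨(q.1.1, q.1.2.right h), q.2.2 h⟩
  continuous_toFun := by
    have hfst : Continuous fun q : fiberJoin E S R => q.1.1 :=
      continuous_fst.comp continuous_subtype_val
    have hsnd : Continuous fun q : fiberJoin E S R => q.1.2 :=
      continuous_snd.comp continuous_subtype_val
    refine BinaryJoin.continuous_mk (Join.continuous_weight_comp hsnd true)
      (BinaryJoin.continuous_left (hsnd.comp continuous_subtype_val) _) ?_
    exact ((hfst.comp continuous_subtype_val).prodMk
      (BinaryJoin.continuous_right (hsnd.comp continuous_subtype_val) _)).subtype_mk _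

theorem continuous_expandBase (hS : Bornology.IsBounded S) (hR : ∀ q ∈ R, q.1 ∈ S) :
    Continuous (expandBase t : BinaryJoin E R → V) := by
  obtain ⟨C, hC⟩ := hS.exists_norm_le
  have hκ : Continuous fun z : BinaryJoin E R => min 1 (2 * z.weight true) :=
    continuous_const.min (continuous_const.mul (Join.continuous_weight true))
  refine continuous_const.add (continuous_scaled hκ (C := C + ‖t‖)
    (fun z => le_min zero_le_one (by linarith [z.weight_nonneg true])) (fun z h => ?_) ?_)
  · exact (norm_sub_le _ _).trans (by gcongr; exact hC _ (hR _ (z.right _).2))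
  · exact (continuous_fst.comp (continuous_subtype_val.comp
      (BinaryJoin.continuous_right continuous_subtype_val _))).sub continuous_const

section Expand

variable (hS : StarConvex ℝ t S) (ht : t ∈ S) (hS' : Bornology.IsBounded S)
  (hR : ∀ q ∈ R, q.1 ∈ S)

/-- A homotopy inverse of `fiberJoinCollapse`. -/
def fiberJoinExpand : C(BinaryJoin E R, fiberJoin E S R) where
  toFun z := ⟨(expandBase t z, BinaryJoin.mk (BinaryJoin.squeeze (1, z)).weight_true_mem
    (BinaryJoin.squeeze (1, z)).left fun h => ((BinaryJoin.squeeze (1, z)).right h).1.2),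
    expandBase_mem hS ht hR z, fun h => by
      have hr := ((BinaryJoin.squeeze (1, z)).right h).2
      rw [expandBase_of_squeezedWeight_pos h]
      exact hr⟩
  continuous_toFun := by
    have hsq : Continuous fun z : BinaryJoin E R => BinaryJoin.squeeze (1, z) :=
      BinaryJoin.squeeze.continuous.comp (Continuous.prodMk_right 1)
    refine ((continuous_expandBase hS' hR).prodMk (BinaryJoin.continuous_mk
      (Join.continuous_weight_comp hsq true)
      (BinaryJoin.continuous_left (hsq.comp continuous_subtype_val) _) ?_)).subtype_mk _
    exact continuous_snd.comp (continuous_subtype_val.comp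
      (BinaryJoin.continuous_right (hsq.comp continuous_subtype_val) _))

theorem collapse_expand (z : BinaryJoin E R) :
    fiberJoinCollapse E S R (fiberJoinExpand hS ht hS' hR z) = BinaryJoin.squeeze (1, z) := by
  refine BinaryJoin.ext rfl (fun _ _ => rfl) fun h _ => Subtype.ext (Prod.ext ?_ rfl)
  exact expandBase_of_squeezedWeight_pos h _

theorem expand_collapse (q : fiberJoin E S R) :
    (fiberJoinExpand hS ht hS' hR (fiberJoinCollapse E S R q)).1 =
      (t + min 1 (2 * q.1.2.weight true) • (q.1.1 - t), BinaryJoin.squeeze (1, q.1.2)) := by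
  refine Prod.ext ?_ (BinaryJoin.ext rfl (fun _ _ => rfl) fun _ _ => rfl)
  obtain h | h := (q.1.2.weight_nonneg true).lt_or_eq
  · exact expandBase_of_pos h
  · refine (expandBase_of_not_pos h.not_lt).trans ?_
    simp [← h]

variable (E S R) in
/-- The homotopy `squeeze`, fibrewise. -/
def fiberJoinSqueeze : C(unitInterval × fiberJoin E S R, fiberJoin E S R) where
  toFun q := ⟨(q.2.1.1, BinaryJoin.squeeze (q.1, q.2.1.2)), q.2.2.1, fun _ => q.2.2.2 _⟩
  continuous_toFun := by fun_prop

variable (E R) in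
/-- The homotopy that contracts `S` to `t` where the weight of the second factor is small. -/
def fiberJoinContract : C(unitInterval × fiberJoin E S R, fiberJoin E S R) where
  toFun q :=
    ⟨(t + (1 - q.1.1 + q.1.1 * min 1 (2 * q.2.1.2.weight true)) • (q.2.1.1 - t),
      BinaryJoin.squeeze (1, q.2.1.2)),
      hS.add_smul_sub_mem q.2.2.1
        (add_nonneg (sub_nonneg.2 q.1.2.2) (mul_nonneg q.1.2.1
          (le_min zero_le_one (mul_nonneg zero_le_two (q.2.1.2.weight_nonneg true)))))
        (by nlinarith [q.1.2.1, min_le_left 1 (2 * q.2.1.2.weight true)]),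
      fun h => by
        rw [min_eq_left (BinaryJoin.two_mul_gt_one_of_squeezedWeight_one_pos h).le, mul_one,
          sub_add_cancel, one_smul, add_sub_cancel]
        exact q.2.2.2 _⟩
  continuous_toFun := by
    have hr : Continuous fun q : unitInterval × fiberJoin E S R => q.2.1.2.weight true :=
      Join.continuous_weight_comp (by fun_prop) true
    fun_prop

theorem fiberJoinContract_zero (q : fiberJoin E S R) :
    (fiberJoinContract E R hS (0, q)).1.1 = q.1.1 := by
  simp [fiberJoinContract]

include hS ht hS' hR in
theorem nonempty_homotopyEquiv_fiberJoin :
    Nonempty (ContinuousMap.HomotopyEquiv (fiberJoin E S R) (BinaryJoin E R)) := by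
  have hsqueeze : ContinuousMap.Homotopic ((fiberJoinSqueeze E S R).curry 1) (.id _) :=
    ⟨(ContinuousMap.Homotopy.symm
      { toContinuousMap := fiberJoinSqueeze E S R
        map_zero_left := fun q => Subtype.ext (Prod.ext rfl (BinaryJoin.squeeze_zero _))
        map_one_left := fun _ => rfl })⟩
  have hcontract : ContinuousMap.Homotopic
      ((fiberJoinExpand hS ht hS' hR).comp (fiberJoinCollapse E S R))
      ((fiberJoinSqueeze E S R).curry 1) :=
    ⟨(ContinuousMap.Homotopy.symm
      { toContinuousMap := fiberJoinContract E R hS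
        map_zero_left := fun q => Subtype.ext (Prod.ext (fiberJoinContract_zero hS q) rfl)
        map_one_left := fun q => Subtype.ext <| by
          rw [ContinuousMap.comp_apply, expand_collapse]
          simp [fiberJoinContract] })⟩
  exact ⟨{
    toFun := fiberJoinCollapse E S R
    invFun := fiberJoinExpand hS ht hS' hR
    left_inv := hcontract.trans hsqueeze
    right_inv := ⟨(ContinuousMap.Homotopy.symm
      { toContinuousMap := BinaryJoin.squeeze
        map_zero_left := BinaryJoin.squeeze_zero
        map_one_left := fun z => (collapse_expand hS ht hS' hR z).symm })⟩ }⟩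

end Expand

end FiberJoin

/-! ### Homotopy colimits of suspended diagrams -/

section Suspension

variable {P : Type v} [PartialOrder P] {κ : Bool → Type w} {l : P → Set (κ true)}

/-- The diagram of index sets with `κ false` adjoined to every member of `l`. -/
def suspend (l : P → Set (κ true)) (p : P) : Set (Σ b, κ b) :=
  {i | match i with
    | ⟨false, _⟩ => True
    | ⟨true, j⟩ => j ∈ l p}

theorem suspend_strictAnti (hl : StrictAnti l) : StrictAnti (suspend l) := by
  intro p q h
  refine ⟨?_, fun h' => (hl h).2 fun j hj => h' (a := ⟨true, j⟩) hj⟩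
  rintro ⟨_ | _, i⟩ hi
  exacts [trivial, (hl h).1 hi]

/-- The members of a suspended diagram of index sets. -/
def suspendEquiv (l : P → Set (κ true)) (p : P) : suspend l p ≃ κ false ⊕ l p where
  toFun
    | ⟨⟨false, i⟩, _⟩ => Sum.inl i
    | ⟨⟨true, j⟩, hj⟩ => Sum.inr ⟨j, hj⟩
  invFun := Sum.elim (fun i => ⟨⟨false, i⟩, trivial⟩) fun j => ⟨⟨true, j.1⟩, j.2⟩
  left_inv := by rintro ⟨⟨_ | _, i⟩, _⟩ <;> rfl
  right_inv := by rintro (i | i) <;> rfl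

variable [Fintype P]

theorem starConvex_orderComplex [DecidableEq P] {A : Set P} {t : P} (ht : ∀ p, p ≤ t)
    (htA : t ∈ A) : StarConvex ℝ (Pi.single t 1) (orderComplex A) := by
  intro b hb r s hr hs hrs
  have hsupp : ∀ p, 0 < (r • (Pi.single t 1 : P → ℝ) + s • b) p → p = t ∨ 0 < b p := by
    intro p hp
    by_contra! h
    simp only [Pi.add_apply, Pi.smul_apply, Pi.single_eq_of_ne h.1, smul_eq_mul, mul_zero,
      zero_add] at hp
    exact hp.not_ge (mul_nonpos_of_nonneg_of_nonpos hs h.2)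
  refine ⟨convex_stdSimplex ℝ P (single_mem_stdSimplex ℝ t) hb.1 hr hs hrs, fun p hp => ?_,
    (hb.2.2.insert fun p _ _ => Or.inr (ht p)).mono hsupp⟩
  obtain rfl | h := hsupp p hp
  exacts [htA, hb.2.1 p h]

theorem single_mem_orderComplex [DecidableEq P] {A : Set P} {t : P} (htA : t ∈ A) :
    Pi.single t 1 ∈ orderComplex A := by
  have hsupp : ∀ p, 0 < (Pi.single t 1 : P → ℝ) p → p = t := fun p hp => by
    by_contra h
    exact hp.ne' (Pi.single_eq_of_ne h 1)
  refine ⟨single_mem_stdSimplex ℝ t, fun p hp => hsupp p hp ▸ htA, ?_⟩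
  exact IsChain.mono hsupp (IsChain.singleton (a := t))

variable [∀ b, Fintype (κ b)] (X : Type u) [TopologicalSpace X]

variable (κ) in
/-- Joins of copies of `X` over a disjoint union of two index sets. -/
def joinHomeomorphBinaryJoin : (Join fun _ : Σ b, κ b => X) ≃ₜ
    BinaryJoin (Join fun _ : κ false => X) (Join fun _ : κ true => X) :=
  (Join.sigmaHomeomorph fun _ => X).trans <| Join.homeomorph fun
    | false => Homeomorph.ulift.symm
    | true => Homeomorph.ulift.symm

/-- The homotopy colimit of a suspended diagram of joins as a fibrewise join. -/
def realizationSuspendHomeomorph (A : Set P) (l : P → Set (κ true)) :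
    realization X A (suspend l) ≃ₜ
      fiberJoin (Join fun _ : κ false => X) (orderComplex A) (realization X A l) :=
  ((Homeomorph.refl _).prodCongr (joinHomeomorphBinaryJoin κ X)).subtype fun y => by
    refine and_congr_right fun hy => ⟨fun h hpos => ⟨hy, fun p hp j hj => ?_⟩, ?_⟩
    · exact h p hp (i := ⟨true, j⟩) ((Join.weight_pos_iff y.2 ⟨true, j⟩).2 ⟨hpos, hj⟩)
    · rintro h p hp ⟨_ | _, j⟩ hj
      · trivial
      · obtain ⟨hpos, hj'⟩ := (Join.weight_pos_iff y.2 ⟨true, j⟩).1 hj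
        exact (h hpos).2 p hp hj'

theorem nonempty_homotopyEquiv_realization_suspend {A : Set P} {t : P} (ht : ∀ p, p ≤ t)
    (htA : t ∈ A) (l : P → Set (κ true)) :
    Nonempty (ContinuousMap.HomotopyEquiv (realization X A (suspend l))
      (BinaryJoin (Join fun _ : κ false => X) (realization X A l))) := by
  classical
  obtain ⟨e⟩ := nonempty_homotopyEquiv_fiberJoin (E := Join fun _ : κ false => X)
    (R := realization X A l) (starConvex_orderComplex ht htA) (single_mem_orderComplex htA)
    ((bounded_stdSimplex P).subset fun _ hb => hb.1) fun _ hq => hq.1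
  exact ⟨(realizationSuspendHomeomorph X A l).toHomotopyEquiv.trans e⟩

end Suspension

/-! ### Coordinates on the homotopy colimit of the diagram of an immersion -/

namespace SubJoin

variable {X : Type u} [TopologicalSpace X] {ι : Type v} [Fintype ι]

/-- `SubJoin X B` as a subspace of the join over all indices. -/
def subtypeHomeomorph (B : Set ι) :
    SubJoin X B ≃ₜ {x : Join fun _ : ι => X // ∀ ⦃i⦄, 0 < x.weight i → i ∈ B} where
  toFun x := ⟨forget x, fun _ => x.mem_of_weight_pos⟩
  invFun x := restrict x.1 x.2
  left_inv _ := rfl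
  right_inv _ := rfl
  continuous_toFun := continuous_forget.subtype_mk _
  continuous_invFun := continuous_restrict continuous_subtype_val _

theorem isClosedEmbedding_forget (B : Set ι) :
    Topology.IsClosedEmbedding (forget : SubJoin X B → _) := by
  have hB : IsClosed {x : Join fun _ : ι => X | ∀ i, 0 < x.weight i → i ∈ B} := by
    simp only [← not_le, not_imp_comm (a := _ ≤ _), Set.ofPred_forall]
    exact isClosed_iInter fun i => isClosed_iInter fun _ =>
      isClosed_le (Join.continuous_weight i) continuous_const
  exact hB.isClosedEmbedding_subtypeVal.comp (subtypeHomeomorph B).isClosedEmbedding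

end SubJoin

section Support

variable {P : Type v} [Finite P]

theorem isClosed_setOf_support {Q : Set P → Prop} (hQ : ∀ ⦃s t⦄, s ⊆ t → Q t → Q s) :
    IsClosed {b : P → ℝ | Q (Function.support b)} := by
  rw [← isOpen_compl_iff, isOpen_iff_mem_nhds]
  intro b hb
  have hsupp : ∀ᶠ b' in nhds b, ∀ p, b p ≠ 0 → b' p ≠ 0 :=
    Filter.eventually_all.2 fun p => Filter.eventually_imp_distrib_left.2 fun hp =>
      (continuous_apply p).continuousAt.eventually_ne hp
  filter_upwards [hsupp] with b' h hb'
  exact hb (hQ h hb')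

variable [PartialOrder P]

theorem exists_isGreatest_of_isChain {s : Set P} (hs : IsChain (· ≤ ·) s) (hne : s.Nonempty) :
    ∃ m, IsGreatest s m := by
  obtain ⟨m, hm⟩ := s.toFinite.exists_maximal hne
  exact ⟨m, hm.1, fun q hq => (hs.total hq hm.1).elim id fun h => hm.2 hq h⟩

theorem exists_isLeast_of_isChain {s : Set P} (hs : IsChain (· ≤ ·) s) (hne : s.Nonempty) :
    ∃ m, IsLeast s m :=
  exists_isGreatest_of_isChain (P := Pᵒᵈ) hs.symm hne

end Support

theorem isClosedEmbedding_orderComplexBelow (P : Type v) [PartialOrder P] [Fintype P] (p : P) :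
    Topology.IsClosedEmbedding (Subtype.val : OrderComplexBelow P p → P → ℝ) :=
  ((isClosed_stdSimplex ℝ P).inter <| isClosed_setOf_support
    (Q := fun s => IsChain (· ≤ ·) s ∧ ∀ q ∈ s, q ≤ p)
    fun _ _ h hQ => ⟨hQ.1.mono h, fun q hq => hQ.2 q (h hq)⟩).isClosedEmbedding_subtypeVal

section Immersion

variable {α : Type v} {M : Matroid α} [M.Finite] {X : Type u} [TopologicalSpace X] {ρ : ℕ}
  (l : Immersion M ρ)

/-- The map sending the class of `(b, x)` to the barycentric coordinates `b` and the image of `x` in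
the join over all indices. -/
def hocolimCoord (y : Hocolim (flatDiagram X l)) : (Flats M → ℝ) × Join fun _ : Fin ρ => X :=
  Quot.lift (fun y : PreHocolim (flatDiagram X l) =>
    (y.2.1.1, SubJoin.forget (B := (l.toFun y.1 : Set (Fin ρ))) y.2.2))
    (by rintro _ _ ⟨h, a, x⟩; rfl) y

theorem isClosedEmbedding_hocolimCoord_mk (p : Flats M) : Topology.IsClosedEmbedding
    fun y : OrderComplexBelow (Flats M) p × (flatDiagram X l).obj (Opposite.op p) =>
      hocolimCoord l (Quot.mk _ ⟨p, y⟩) :=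
  (isClosedEmbedding_orderComplexBelow (Flats M) p).prodMap
    (SubJoin.isClosedEmbedding_forget (l.toFun p : Set (Fin ρ)))

theorem continuous_hocolimCoord : Continuous (hocolimCoord (X := X) l) :=
  continuous_quot_lift _ (continuous_sigma fun p =>
    (isClosedEmbedding_hocolimCoord_mk l p).continuous)

theorem isClosedMap_hocolimCoord : IsClosedMap (hocolimCoord (X := X) l) := by
  intro C hC
  have himage : hocolimCoord l '' C = ⋃ p : Flats M, (fun y : OrderComplexBelow (Flats M) p ×
      (flatDiagram X l).obj (Opposite.op p) => hocolimCoord l (Quot.mk _ ⟨p, y⟩)) ''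
        {y | (Quot.mk _ ⟨p, y⟩ : Hocolim (flatDiagram X l)) ∈ C} := by
    ext z
    simp only [Set.mem_image, Set.mem_iUnion]
    constructor
    · rintro ⟨⟨p, y⟩, hy, rfl⟩
      exact ⟨p, y, hy, rfl⟩
    · rintro ⟨p, y, hy, rfl⟩
      exact ⟨_, hy, rfl⟩
  rw [himage]
  refine isClosed_iUnion_of_finite fun p =>
    (isClosedEmbedding_hocolimCoord_mk l p).isClosedMap _ ?_
  exact hC.preimage (continuous_quot_mk.comp continuous_sigmaMk)

theorem mk_eq_mk_of_isGreatest {p m : Flats M} (b : OrderComplexBelow (Flats M) p)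
    (x : (flatDiagram X l).obj (Opposite.op p)) (hm : IsGreatest {q | b.1 q ≠ 0} m) :
    (Quot.mk _ ⟨p, b, x⟩ : Hocolim (flatDiagram X l)) =
      Quot.mk _ ⟨m, ⟨b.1, b.2.1, b.2.2.1, hm.2⟩,
        (flatDiagram X l).map (CategoryTheory.homOfLE (b.2.2.2 m hm.1)).op x⟩ :=
  Quot.sound (HocolimRel.glue (b.2.2.2 m hm.1) ⟨b.1, b.2.1, b.2.2.1, hm.2⟩ x)

theorem injective_hocolimCoord : Function.Injective (hocolimCoord (X := X) l) := by
  rintro ⟨p, b, x⟩ ⟨p', b', x'⟩ h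
  obtain ⟨q, hq⟩ := exists_pos_of_mem_stdSimplex b.2.1
  obtain ⟨m, hm⟩ := exists_isGreatest_of_isChain b.2.2.1 ⟨q, hq.ne'⟩
  have hb : b.1 = b'.1 := congrArg Prod.fst h
  have hmk := mk_eq_mk_of_isGreatest l b x hm
  have hmk' := mk_eq_mk_of_isGreatest l b' x' (hb ▸ hm)
  rw [hmk, hmk'] at h ⊢
  rw [(isClosedEmbedding_hocolimCoord_mk l m).injective h]

theorem image_rep : hocolimCoord l '' rep X l =
    realization X {p | p ≠ ⊥} fun p => (l.toFun p : Set (Fin ρ)) := by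
  refine subset_antisymm ?_ ?_
  · rintro _ ⟨y, hy, rfl⟩
    obtain ⟨a, ha, p, b, x, hab, rfl⟩ := Set.mem_iUnion₂.1 hy
    refine ⟨⟨b.2.1, fun q hq => ha.bot_lt.trans_le (hab q hq.ne') |>.ne',
      b.2.2.1.mono fun q hq => ne_of_gt hq⟩, fun q hq i hi => ?_⟩
    exact l.antitone (b.2.2.2 q hq.ne') (x.point i hi).2
  · rintro ⟨b, x⟩ ⟨⟨hb, hA, hchain⟩, hx⟩
    have hpos : ∀ q, b q ≠ 0 → 0 < b q := fun q hq => (hb.1 q).lt_of_ne' hq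
    have hchain' : IsChain (· ≤ ·) {q | b q ≠ 0} := hchain.mono hpos
    obtain ⟨q, hq⟩ := exists_pos_of_mem_stdSimplex hb
    obtain ⟨m, hm, hmax⟩ := exists_isGreatest_of_isChain hchain' ⟨q, hq.ne'⟩
    obtain ⟨n, hn, hmin⟩ := exists_isLeast_of_isChain hchain' ⟨q, hq.ne'⟩
    obtain ⟨a, ha, han⟩ := (eq_bot_or_exists_atom_le n).resolve_left (hA n (hpos n hn))
    have hab : ∀ q, b q ≠ 0 → a ≤ q := fun q hq => han.trans (hmin hq)
    let x' : SubJoin X (l.toFun m : Set (Fin ρ)) := SubJoin.restrict x (hx m (hpos m hm))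
    exact ⟨Quot.mk _ ⟨m, ⟨b, hb, hchain', hmax⟩, x'⟩,
      Set.mem_iUnion₂.2 ⟨a, ha, m, _, x', hab, rfl⟩, rfl⟩

/-- The topological representation of an immersion in coordinates. -/
def repHomeomorph :
    rep X l ≃ₜ realization X {p | p ≠ ⊥} fun p => (l.toFun p : Set (Fin ρ)) :=
  ((Topology.IsClosedEmbedding.of_continuous_injective_isClosedMap (continuous_hocolimCoord l)
    (injective_hocolimCoord l) (isClosedMap_hocolimCoord l)).isEmbedding.homeomorphImage
      (rep X l)).trans (Homeomorph.setCongr (image_rep l))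

end Immersion

/-! ### Comparison of immersions -/

section Comparison

variable {α : Type v} {M : Matroid α}

theorem rk_bot : rk M (⊥ : Flats M).1 = 0 := by
  have h : M.eRk (M.closure ∅) = 0 := by rw [M.eRk_closure_eq, M.eRk_empty]
  exact congrArg ENat.toNat h

theorem rk_lt_rk [M.Finite] {p q : Flats M} (h : p < q) : rk M p.1 < rk M q.1 := by
  refine (rk_mono M h.le).lt_of_ne fun heq => h.ne (Subtype.ext ?_)
  have hp := M.isRkFinite_set p.1
  have hle : M.eRk q.1 ≤ M.eRk p.1 := by
    rw [← ENat.natCast_toNat (M.eRk_ne_top_iff.2 hp),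
      ← ENat.natCast_toNat (M.eRk_ne_top_iff.2 (M.isRkFinite_set q.1))]
    exact Nat.cast_le.2 heq.ge
  rw [← p.2.closure, ← q.2.closure]
  exact hp.closure_eq_closure_of_subset_of_eRk_ge_eRk h.le hle

/-- The ground set, as the greatest flat. -/
def groundFlat (M : Matroid α) : Flats M := ⟨M.E, M.ground_isFlat⟩

theorem le_groundFlat (p : Flats M) : p ≤ groundFlat M := p.2.subset_ground

theorem groundFlat_ne_bot (h : 1 ≤ rank M) : groundFlat M ≠ ⊥ := fun hbot => by
  have hrk : rank M = rk M (⊥ : Flats M).1 := congrArg (fun p : Flats M => rk M p.1) hbot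
  rw [rk_bot] at hrk
  omega

theorem exists_equiv_mem_iff {ι ι' : Type*} [Finite ι] [Finite ι'] {B : Set ι} {B' : Set ι'}
    (h : Nat.card ι' = Nat.card ι) (hB : Nat.card B' = Nat.card B) :
    ∃ σ : ι' ≃ ι, ∀ i, i ∈ B' ↔ σ i ∈ B := by
  classical
  obtain ⟨τ⟩ := Finite.card_eq.1 h
  obtain ⟨e⟩ := Finite.card_eq.1 hB
  let f : {i // i ∈ B'} ≃ {i // τ i ∈ B} :=
    e.trans (τ.symm.subtypeEquiv fun i => by rw [τ.apply_symm_apply])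
  refine ⟨f.extendSubtype.trans τ, fun i => ⟨fun hi => f.extendSubtype_mem i hi, ?_⟩⟩
  exact fun hi => by_contra fun hi' => f.extendSubtype_not_mem i hi' hi

namespace Immersion

variable {ρ : ℕ}

theorem strictAnti [M.Finite] (l : Immersion M ρ) :
    StrictAnti fun p => (l.toFun p : Set (Fin ρ)) := by
  intro p q h
  refine Finset.coe_ssubset.2 ((l.antitone h.le).ssubset_of_ne fun heq => ?_)
  have hp := l.card_add_rk p
  have hq := l.card_add_rk q
  have := rk_lt_rk h
  rw [heq] at hq
  omega

theorem rank_le (l : Immersion M ρ) : rank M ≤ ρ :=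
  (Nat.le_add_left _ _).trans_eq (l.card_add_rk (groundFlat M))

theorem exists_equiv_mem_suspend_iff {n m : ℕ} (l : Immersion M ρ) (c : Immersion M n)
    (h : m + n = ρ) (p : Flats M) :
    ∃ σ : (Σ b, Fin (cond b n m)) ≃ Fin ρ,
      ∀ i, i ∈ suspend (κ := fun b => Fin (cond b n m)) (fun p => (c.toFun p : Set (Fin n))) p ↔
        σ i ∈ (l.toFun p : Set (Fin ρ)) := by
  refine exists_equiv_mem_iff ?_ ?_
  · rw [Nat.card_sigma, Fintype.sum_bool]
    simpa [add_comm n] using h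
  · have hl := l.card_add_rk p
    have hc := c.card_add_rk p
    rw [Nat.card_congr (suspendEquiv _ p), Nat.card_sum]
    simp only [cond_false, cond_true, Nat.card_eq_fintype_card, Fintype.card_fin,
      SetLike.coe_sort_coe, Fintype.card_coe]
    omega

end Immersion

variable [M.Finite] (X : Type u) [TopologicalSpace X] {ρ : ℕ} (l : Immersion M ρ)

theorem isEmpty_rep (h : rank M = 0) : IsEmpty (rep X l) := by
  refine (repHomeomorph l).toEquiv.isEmpty_congr.2 ⟨fun y => ?_⟩
  obtain ⟨p, hp⟩ := exists_pos_of_mem_stdSimplex y.2.1.1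
  have hpbot : ⊥ < p := bot_lt_iff_ne_bot.2 (y.2.1.2.1 p hp)
  have hrk := rk_lt_rk hpbot
  have hle : rk M p.1 ≤ rank M := rk_mono M p.2.subset_ground
  omega

theorem isEmpty_binaryJoin_standardRep (h : rank M = 0) :
    IsEmpty (BinaryJoin (JoinPower X 0) (standardRep M X)) := by
  have : IsEmpty (JoinPower X 0) :=
    ⟨fun x => (exists_pos_of_mem_stdSimplex x.weight_mem).choose.elim0⟩
  have : IsEmpty (standardRep M X) := isEmpty_rep X _ h
  have : ∀ b, IsEmpty (pairFamily (JoinPower X 0) (standardRep M X) b)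
    | false => inferInstanceAs (IsEmpty (ULift _))
    | true => inferInstanceAs (IsEmpty (ULift _))
  exact Join.isEmpty

theorem nonempty_homotopyEquiv_rep (h : 1 ≤ rank M) :
    Nonempty (ContinuousMap.HomotopyEquiv (rep X l)
      (BinaryJoin (JoinPower X (ρ - rank M)) (standardRep M X))) := by
  let c := canonicalImmersion M (rank M) le_rfl
  obtain ⟨f⟩ := nonempty_homotopyEquiv_realization X {p : Flats M | p ≠ ⊥} l.strictAnti
    (suspend_strictAnti (κ := fun b => Fin (cond b (rank M) (ρ - rank M))) c.strictAnti)
    (l.exists_equiv_mem_suspend_iff c (Nat.sub_add_cancel l.rank_le))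
  obtain ⟨g⟩ := nonempty_homotopyEquiv_realization_suspend
    (κ := fun b => Fin (cond b (rank M) (ρ - rank M))) (A := {p : Flats M | p ≠ ⊥}) X
    le_groundFlat (groundFlat_ne_bot h) fun p => (c.toFun p : Set (Fin (rank M)))
  exact ⟨((repHomeomorph l).toHomotopyEquiv.trans f).trans (g.trans
    (BinaryJoin.congrRight (JoinPower X (ρ - rank M)) (repHomeomorph c).symm).toHomotopyEquiv)⟩

end Comparison

end MatroidTop

end

theorem mainTheorem9_general {α : Type*} (M : Matroid α) [M.Finite]
    (X : Type*) [TopologicalSpace X] (ρ : ℕ) (l : MatroidTop.Immersion M ρ)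
    (hρ : 1 ≤ MatroidTop.rank M ∨ ρ = MatroidTop.rank M) :
    Nonempty (ContinuousMap.HomotopyEquiv (MatroidTop.rep X l)
      (MatroidTop.BinaryJoin (MatroidTop.JoinPower X (ρ - MatroidTop.rank M))
        (MatroidTop.standardRep M X))) := by
  obtain hM | hM := (MatroidTop.rank M).eq_zero_or_pos
  · obtain rfl : ρ = MatroidTop.rank M := hρ.resolve_left (by omega)
    have := MatroidTop.isEmpty_rep X l hM
    rw [Nat.sub_self]
    have := MatroidTop.isEmpty_binaryJoin_standardRep X hM
    exact ⟨Homeomorph.empty.toHomotopyEquiv⟩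
  · exact MatroidTop.nonempty_homotopyEquiv_rep X l hM

theorem mainTheorem9 {α : Type*} (M : Matroid α) [M.Finite]
    (X : Type*) [TopologicalSpace X] [T2Space X] [Topology.CWComplex (Set.univ : Set X)]
    (ρ : ℕ) (l : MatroidTop.Immersion M ρ)
    (hρ : 1 ≤ MatroidTop.rank M ∨ ρ = MatroidTop.rank M) :
    Nonempty (ContinuousMap.HomotopyEquiv (MatroidTop.rep X l)
      (MatroidTop.BinaryJoin (MatroidTop.JoinPower X (ρ - MatroidTop.rank M))
        (MatroidTop.standardRep M X))) :=
  mainTheorem9_general M X ρ l hρ
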